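/- **Setting.** Let $\mathbb D$ be the open unit disc in $\mathbb C=\mathbb R^2$. A conformal homeomorphism is a holomorphic bijection between planar domains. A simply connected planar domain $\Omega$ is called conformal $\alpha$-regular, where $\alpha>2$, if $\iint_{\mathbb D}|(\varphi^{-1})'|^{\alpha}\,du\,dv<\infty$ for some conformal homeomorphism $\varphi:\Omega\to\mathbb D$. For $\alpha_0\in(-2,0)$, (inverse) Brennan's conjecture on $[\alpha_0,2/3)$ is the assertion that $\iint_{\mathbb D}|\psi'|^{\beta}\,du\,dv<\infty$ for every conformal homeomorphism $\psi$ of $\mathbb D$ onto a simply connected planar domain and every $\beta\in[\alpha_0,2/3)$. $W^{1,p}(\Omega)$ is the space of real functions in $L^p(\Omega)$ with weak gradient in $L^p(\Omega)$; $L^{1,p}(\Omega)$ is the space of locally integrable, weakly differentiable functions with $\|\nabla f\|_{L^p(\Omega)}<\infty$. $B_{s,p}(\Omega)\in[0,\infty]$ is the best constant in $\inf_{c\in\mathbb R}\|f-c\|_{L^s(\Omega)}\le B\,\|\nabla f\|_{L^p(\Omega)}$, $f\in W^{1,p}(\Omega)$. For a conformal homeomorphism $\varphi:\Omega\to\mathbb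 D$ and $h=|\varphi'|^2$, $B_{r,p}(\Omega,h)\in[0,\infty]$ is the best constant in $\inf_{c\in\mathbb R}\left(\iint_\Omega|f-c|^r h\,dx\,dy\right)^{1/r}\le B\,\|\nabla f\|_{L^p(\Omega)}$, $f\in W^{1,p}(\Omega)$. $K_{p,q}\in[0,\infty]$ is the norm of the composition operator $f\mapsto f\circ\varphi^{-1}$ from $L^{1,p}(\Omega)$ to $L^{1,q}(\mathbb D)$ ($\infty$ if the operator is not bounded). **Theorem B.** Let $\alpha_0\in(-2,0)$ and suppose that Brennan's conjecture holds on $[\alpha_0,2/3)$. Let $\Omega$ be a conformal $\alpha$-regular domain and $\varphi:\Omega\to\mathbb D$ a conformal homeomorphism. Let $$p\in\left(\max\left\{\frac43,\ \frac{2\alpha(|\alpha_0|+2)}{2\alpha+3\alpha|\alpha_0|-4|\alpha_0|}\right\},\,2\right),\qquad s\in\left[1,\ \frac{\alpha-2}{\alpha}\cdot\frac{p}{2-p}\cdot\frac{|\alpha_0|}{2+|\alpha_0|}\right],$$ and $r=\alpha s/(\alpha-2)$. Then $B_{s,p}(\Omega)<\infty$, so that $$\inf_{c\in\mathbb R}\|f-c\|_{L^s(\Omega)}\le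 B_{s,p}(\Omega)\,\|\nabla f\|_{L^p(\Omega)}\qquad\text{for all } f\in W^{1,p}(\Omega),$$ and the constant satisfies $$B_{s,p}(\Omega)\le\|(\varphi^{-1})'\|_{L^\alpha(\mathbb D)}^{2/s}\,B_{r,p}(\Omega,h)\le\inf_{q\in[1,2p/(4-p))}\left\{B_{r,q}(\mathbb D)\,\|(\varphi^{-1})'\|_{L^\alpha(\mathbb D)}^{2/s}\,K_{p,q}\right\}<\infty .$$ Moreover, for every $q\in[1,2p/(4-p))$, $$K_{p,q}\le\left(\iint_{\mathbb D}|(\varphi^{-1})'|^{\frac{(p-2)q}{p-q}}\,du\,dv\right)^{\frac{p-q}{pq}}\quad(\text{the right-hand side may be }\infty).$$ -/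

import Mathlib

open MeasureTheory Set Metric
open scoped ENNReal NNReal ContDiff

/-- The open unit disc `𝔻` in `ℂ = ℝ²`. -/
def unitDisc : Set ℂ := ball 0 1

/-- `φ` is a conformal homeomorphism of `U` onto `V`: a holomorphic bijection. -/
structure IsConformalOnto (φ : ℂ → ℂ) (U V : Set ℂ) : Prop where
  holo : DifferentiableOn ℂ φ U
  bij : BijOn φ U V

/-- `φ : Ω → 𝔻` is a conformal homeomorphism and `ψ : 𝔻 → Ω` is its inverse. -/
structure IsRiemannPair (Ω : Set ℂ) (φ ψ : ℂ → ℂ) : Prop where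
  conformal : IsConformalOnto φ Ω unitDisc
  inv : InvOn ψ φ Ω unitDisc

/-- A simply connected planar domain. -/
structure IsSimplyConnectedDomain (Ω : Set ℂ) : Prop where
  isOpen : IsOpen Ω
  simplyConnected : IsSimplyConnected Ω

/-- `Ω` is a conformal `α`-regular domain: `α > 2`, `Ω` is a simply connected planar domain, and
`∬_𝔻 |(φ⁻¹)'|^α < ∞` for some conformal `φ : Ω → 𝔻`. -/
def IsConformalRegular (α : ℝ) (Ω : Set ℂ) : Prop :=
  2 < α ∧ IsSimplyConnectedDomain Ω ∧
    ∃ φ ψ : ℂ → ℂ, IsRiemannPair Ω φ ψ ∧ ∫⁻ w in unitDisc, ‖deriv ψ w‖ₑ ^ α < ⊤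

/-- The (inverse) Brennan conjecture for the interval `[α₀, 2/3)`: for every conformal
homeomorphism `ψ` of `𝔻` onto a planar domain `Ω` and every `β ∈ [α₀, 2/3)`,
`∬_𝔻 |ψ'|^β < ∞`. -/
def BrennanConjectureOn (α₀ : ℝ) : Prop :=
  ∀ (Ω : Set ℂ) (ψ : ℂ → ℂ), IsSimplyConnectedDomain Ω → IsConformalOnto ψ unitDisc Ω →
    ∀ β ∈ Ico α₀ (2 / 3 : ℝ), ∫⁻ w in unitDisc, ‖deriv ψ w‖ₑ ^ β < ⊤

/-- `f` is locally integrable and weakly differentiable on `Ω`, with weak gradient `G`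
(a vector field with values in `ℂ = ℝ²`). -/
structure HasWeakGradient (Ω : Set ℂ) (f : ℂ → ℝ) (G : ℂ → ℂ) : Prop where
  locInt : LocallyIntegrableOn f Ω
  locInt_grad : LocallyIntegrableOn G Ω
  byParts : ∀ η : ℂ → ℝ, ContDiff ℝ ∞ η → HasCompactSupport η → tsupport η ⊆ Ω → ∀ v : ℂ,
    ∫ z in Ω, f z * fderiv ℝ η z v = - ∫ z in Ω, inner ℝ (G z) v * η z

/-- `f` belongs to the homogeneous Sobolev space `L^{1,p}(Ω)`, with weak gradient `G`. -/
structure MemL1p (Ω : Set ℂ) (p : ℝ) (f : ℂ → ℝ) (G : ℂ → ℂ) : Prop where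
  weakGrad : HasWeakGradient Ω f G
  memLp_grad : MemLp G (ENNReal.ofReal p) (volume.restrict Ω)

/-- `f` belongs to the Sobolev space `W^{1,p}(Ω)`, with weak gradient `G`. -/
structure MemW1p (Ω : Set ℂ) (p : ℝ) (f : ℂ → ℝ) (G : ℂ → ℂ) : Prop where
  weakGrad : HasWeakGradient Ω f G
  memLp : MemLp f (ENNReal.ofReal p) (volume.restrict Ω)
  memLp_grad : MemLp G (ENNReal.ofReal p) (volume.restrict Ω)

/-- The measure `h dx dy` on `Ω` for the conformal weight `h = J_φ = |φ'|²`. -/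
noncomputable def conformalMeasure (Ω : Set ℂ) (φ : ℂ → ℂ) : Measure ℂ :=
  (volume.restrict Ω).withDensity fun z => ‖deriv φ z‖ₑ ^ 2

/-- The `(r,p)`-Poincaré–Sobolev inequality on `Ω` with constant `B`, the left-hand side taken with
respect to the measure `μ`:
`inf_c ‖f - c‖_{L^r(μ)} ≤ B ‖∇f‖_{L^p(Ω)}` for all `f ∈ W^{1,p}(Ω)`. -/
def PoincareSobolev (Ω : Set ℂ) (μ : Measure ℂ) (r p : ℝ) (B : ℝ≥0) : Prop :=
  ∀ (f : ℂ → ℝ) (G : ℂ → ℂ), MemW1p Ω p f G →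
    (⨅ c : ℝ, eLpNorm (fun z => f z - c) (ENNReal.ofReal r) μ) ≤
      B * eLpNorm G (ENNReal.ofReal p) (volume.restrict Ω)

/-- The best constant of the inequality above (`∞` if there is none). -/
noncomputable def poincareConst (Ω : Set ℂ) (μ : Measure ℂ) (r p : ℝ) : ℝ≥0∞ :=
  ⨅ (B : ℝ≥0) (_ : PoincareSobolev Ω μ r p B), (B : ℝ≥0∞)

/-- `B_{s,p}(Ω)`, the best constant of the non-weighted `(s,p)`-Poincaré–Sobolev inequality. -/
noncomputable def constB (s p : ℝ) (Ω : Set ℂ) : ℝ≥0∞ :=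
  poincareConst Ω (volume.restrict Ω) s p

/-- `B_{r,p}(Ω,h)`, the best constant of the `(r,p)`-Poincaré–Sobolev inequality with the conformal
weight `h = |φ'|²`. -/
noncomputable def constBWeighted (r p : ℝ) (Ω : Set ℂ) (φ : ℂ → ℂ) : ℝ≥0∞ :=
  poincareConst Ω (conformalMeasure Ω φ) r p

/-- `K_{p,q}`, the norm of the composition operator `ψ^* : L^{1,p}(Ω) → L^{1,q}(𝔻)`, `f ↦ f ∘ ψ`
(`∞` if `ψ` does not induce a bounded operator). -/
noncomputable def constK (p q : ℝ) (Ω : Set ℂ) (ψ : ℂ → ℂ) : ℝ≥0∞ :=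
  ⨅ (K : ℝ≥0) (_ : ∀ (f : ℂ → ℝ) (G : ℂ → ℂ), MemL1p Ω p f G →
      ∃ H : ℂ → ℂ, MemL1p unitDisc q (f ∘ ψ) H ∧
        eLpNorm H (ENNReal.ofReal q) (volume.restrict unitDisc) ≤
          K * eLpNorm G (ENNReal.ofReal p) (volume.restrict Ω)), (K : ℝ≥0∞)

/-- `‖ψ' | L^α(𝔻)‖`. -/
noncomputable def derivNorm (α : ℝ) (ψ : ℂ → ℂ) : ℝ≥0∞ :=
  eLpNorm (deriv ψ) (ENNReal.ofReal α) (volume.restrict unitDisc)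

/-! The function `f` is transplanted to the disc as `f ∘ ψ`. Hölder's inequality compares the `L^s`
norm of `f - c` on `Ω` with its `L^r` norm for the weight `|φ'|²`, at the cost of `‖ψ'‖_α^(2/s)`
(`constB_le`). The weight is the Jacobian of `φ`, so the weighted norm is the plain `L^r` norm of `f
∘ ψ - c` on the disc. There the Poincaré–Sobolev inequality and the composition operator give the
product of `B_{r,q}(𝔻)` and `K_{p,q}` (`constBWeighted_le`).

The bound of `K_{p,q}` is Hölder's inequality applied to `|∇(f ∘ ψ)| = |ψ'| |∇f ∘ ψ|` (`constK_le`).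
The weak chain rule behind it (`HasWeakGradient.comp_conformal`) is proved by transporting test
functions, without approximating `f`. With `a = |α₀|` and `q = ap/(2+a-p)` the exponent
`(p-2)q/(p-q)` is `α₀`, so Brennan's conjecture makes `K_{p,q}` finite; the upper bound on `s` then
says exactly `r ≤ q/(2-q)` (`brennan_exponent`).

On the disc (`exists_eLpNorm_sub_le_of_hasWeakGradient`) the exponent `q/(2-q)` therefore suffices.
It follows from Young's inequality for the Riesz kernel `1/|x|`, which lies in `L^q` near `0` for `q
< 2`. The estimate is proved for differences `f z - f w`, first for smooth functions, then by
mollification on smaller discs and exhaustion.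

Two further points: regularity is assumed for one Riemann map and needed for any, which rests on the
form of the disc automorphisms; and the products of constants in `[0,∞]` must not be `0 · ∞`, so
both `B_{r,q}(𝔻)` and `K_{p,q}` are shown to be nonzero. -/

/-! ### Injective holomorphic functions -/

/-- The real determinant of multiplication by a complex number. -/
lemma det_restrictScalars_toSpanSingleton (c : ℂ) :
    ((ContinuousLinearMap.toSpanSingleton ℂ c).restrictScalars ℝ).det = ‖c‖ ^ 2 := by
  have h : LinearMap.det (ContinuousLinearMap.toSpanSingleton ℂ c : ℂ →ₗ[ℂ] ℂ) = c := by
    rw [LinearMap.det_ring]; simp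
  have h2 := LinearMap.det_restrictScalars (R := ℝ)
    (f := (ContinuousLinearMap.toSpanSingleton ℂ c : ℂ →ₗ[ℂ] ℂ))
  rw [h] at h2
  rw [ContinuousLinearMap.det]
  refine h2.trans ?_
  rw [Algebra.norm_complex_apply, Complex.normSq_eq_norm_sq]

/-- Division by `g z₀` moves the value at `z₀` to `1`, inside the slit plane where the principal
root is analytic. The power identity holds at every `z`, also across the cut. -/
lemma AnalyticAt.exists_pow_eq {g : ℂ → ℂ} {z₀ : ℂ} (hg : AnalyticAt ℂ g z₀) (h0 : g z₀ ≠ 0)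
    {n : ℕ} (hn : n ≠ 0) :
    ∃ k : ℂ → ℂ, AnalyticAt ℂ k z₀ ∧ k z₀ ≠ 0 ∧ ∀ z, k z ^ n = g z := by
  obtain ⟨c, hc⟩ := IsAlgClosed.exists_pow_nat_eq (g z₀) (Nat.pos_of_ne_zero hn)
  have hpow : ∀ z, (c * (g z / g z₀) ^ ((n : ℂ)⁻¹)) ^ n = g z := by
    intro z
    rw [mul_pow, hc, Complex.cpow_nat_inv_pow _ hn]
    field_simp
  refine ⟨fun z ↦ c * (g z / g z₀) ^ ((n : ℂ)⁻¹), ?_, ?_, hpow⟩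
  · refine analyticAt_const.mul (AnalyticAt.cpow ?_ analyticAt_const ?_)
    · exact hg.div analyticAt_const h0
    · simp [div_self h0]
  · intro h
    apply h0
    rw [← hpow z₀]
    simp only at h
    rw [h, zero_pow hn]

/-- Near `z₀`, `f - f z₀` is the `n`-th power of a local coordinate `(z - z₀) k(z)`. The coordinate
is open at `z₀`; if `n > 1` it takes both values `ε/2` and `ζε/2`, with `ζ` a primitive `n`-th root
of unity, and `f` agrees at these two points. -/
theorem deriv_ne_zero_of_injOn {f : ℂ → ℂ} {U : Set ℂ} (hU : IsOpen U)
    (hf : DifferentiableOn ℂ f U) (hinj : InjOn f U) {z₀ : ℂ} (hz₀ : z₀ ∈ U) :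
    deriv f z₀ ≠ 0 := by
  have hUn : U ∈ nhds z₀ := hU.mem_nhds hz₀
  have hfa : AnalyticAt ℂ f z₀ := hf.analyticAt hUn
  have hFa : AnalyticAt ℂ (fun z ↦ f z - f z₀) z₀ := hfa.sub analyticAt_const
  have hne : ¬ ∀ᶠ z in nhds z₀, f z - f z₀ = 0 := by
    intro h
    have h2 : ∀ᶠ z in nhdsWithin z₀ {z₀}ᶜ, False := by
      filter_upwards [mem_nhdsWithin_of_mem_nhds h, mem_nhdsWithin_of_mem_nhds hUn,
        self_mem_nhdsWithin] with z h1 h2 h3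
      exact h3 (hinj h2 hz₀ (sub_eq_zero.mp h1))
    rw [Filter.eventually_false_iff_eq_bot] at h2
    exact (inferInstance : (nhdsWithin z₀ {z₀}ᶜ).NeBot).ne h2
  obtain ⟨n, g, hga, hg0, hFg⟩ := hFa.exists_eventuallyEq_pow_smul_nonzero_iff.mpr hne
  have hn : n ≠ 0 := by
    rintro rfl
    have := hFg.self_of_nhds
    simp at this
    exact hg0 this.symm
  obtain ⟨k, hka, hk0, hkg⟩ := hga.exists_pow_eq hg0 hn
  have hpow : ∀ᶠ z in nhds z₀, f z - f z₀ = ((z - z₀) * k z) ^ n := by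
    filter_upwards [hFg] with z hz
    rw [hz, mul_pow, hkg, smul_eq_mul]
  have hh : HasStrictDerivAt (fun z ↦ (z - z₀) * k z) (k z₀) z₀ := by
    have h1 : HasStrictDerivAt (fun z ↦ z - z₀) 1 z₀ := (hasStrictDerivAt_id z₀).sub_const z₀
    simpa using! h1.mul hka.hasStrictDerivAt
  have hn1 : n = 1 := by
    by_contra hn1
    have hmap := hh.map_nhds_eq hk0
    simp only [sub_self, zero_mul] at hmap
    have hV := Filter.image_mem_map (m := fun z ↦ (z - z₀) * k z) (Filter.inter_mem hpow hUn)
    rw [hmap] at hV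
    obtain ⟨ε, hε, hball⟩ := Metric.mem_nhds_iff.mp hV
    have hζ := Complex.isPrimitiveRoot_exp n hn
    set ζ := Complex.exp (2 * Real.pi * Complex.I / n)
    have hζn : ‖ζ‖ = 1 := hζ.norm'_eq_one hn
    have hw1 : ((ε / 2 : ℝ) : ℂ) ∈ ball (0 : ℂ) ε := by
      simp [abs_of_pos hε]; linarith
    have hw2 : ζ * ((ε / 2 : ℝ) : ℂ) ∈ ball (0 : ℂ) ε := by
      rw [mem_ball_zero_iff, norm_mul, hζn, one_mul]
      simpa using hw1
    obtain ⟨z₁, ⟨hz₁, hz₁U⟩, e₁⟩ := hball hw1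
    obtain ⟨z₂, ⟨hz₂, hz₂U⟩, e₂⟩ := hball hw2
    simp only at e₁ e₂
    have h1 : f z₁ - f z₀ = ((ε / 2 : ℝ) : ℂ) ^ n := by rw [← e₁]; exact hz₁
    have h2 : f z₂ - f z₀ = ((ε / 2 : ℝ) : ℂ) ^ n := by
      have : f z₂ - f z₀ = (ζ * ((ε / 2 : ℝ) : ℂ)) ^ n := by rw [← e₂]; exact hz₂
      rw [this, mul_pow, hζ.pow_eq_one, one_mul]
    have h12 : z₁ = z₂ := hinj hz₁U hz₂U (by linear_combination h1 - h2)
    rw [h12, e₂] at e₁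
    have hne : ((ε / 2 : ℝ) : ℂ) ≠ 0 := by
      rw [Ne, Complex.ofReal_eq_zero]; positivity
    have : ζ = 1 := by
      apply mul_right_cancel₀ hne
      rw [e₁, one_mul]
    exact hζ.ne_one (by omega) this
  subst hn1
  have hd : HasDerivAt f (k z₀) z₀ := by
    have h1 := (hh.hasDerivAt).add_const (f z₀)
    refine h1.congr_of_eventuallyEq ?_
    filter_upwards [hpow] with z hz
    rw [pow_one] at hz
    rw [← hz]; ring
  rwa [hd.deriv]

/-! ### Change of variables for injective holomorphic functions. -/

section ChangeOfVariables

variable {f : ℂ → ℂ} {U S : Set ℂ}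

lemma hasFDerivWithinAt_real_of_differentiableOn (hU : IsOpen U) (hf : DifferentiableOn ℂ f U)
    (hSU : S ⊆ U) (x : ℂ) (hx : x ∈ S) :
    HasFDerivWithinAt f ((ContinuousLinearMap.toSpanSingleton ℂ (deriv f x)).restrictScalars ℝ)
      S x :=
  ((hf.differentiableAt (hU.mem_nhds (hSU hx))).hasDerivAt.hasFDerivAt.restrictScalars
    ℝ).hasFDerivWithinAt

theorem lintegral_image_holomorphic (hU : IsOpen U) (hf : DifferentiableOn ℂ f U)
    (hinj : InjOn f U) (hS : MeasurableSet S) (hSU : S ⊆ U) (g : ℂ → ℝ≥0∞) :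
    ∫⁻ x in f '' S, g x = ∫⁻ x in S, ‖deriv f x‖ₑ ^ 2 * g (f x) := by
  rw [lintegral_image_eq_lintegral_abs_det_fderiv_mul volume hS
    (hasFDerivWithinAt_real_of_differentiableOn hU hf hSU) (hinj.mono hSU)]
  simp_rw [det_restrictScalars_toSpanSingleton, abs_of_nonneg (sq_nonneg ‖deriv f _‖),
    ENNReal.ofReal_pow (norm_nonneg _), ofReal_norm]

theorem integral_image_holomorphic (hU : IsOpen U) (hf : DifferentiableOn ℂ f U)
    (hinj : InjOn f U) (hS : MeasurableSet S) (hSU : S ⊆ U) (g : ℂ → ℝ) :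
    ∫ x in f '' S, g x = ∫ x in S, ‖deriv f x‖ ^ 2 * g (f x) := by
  rw [integral_image_eq_integral_abs_det_fderiv_smul volume hS
    (hasFDerivWithinAt_real_of_differentiableOn hU hf hSU) (hinj.mono hSU)]
  simp_rw [det_restrictScalars_toSpanSingleton, abs_of_nonneg (sq_nonneg ‖deriv f _‖), smul_eq_mul]

theorem integrableOn_image_holomorphic_iff {E : Type*} [NormedAddCommGroup E] [NormedSpace ℝ E]
    (hU : IsOpen U) (hf : DifferentiableOn ℂ f U)
    (hinj : InjOn f U) (hS : MeasurableSet S) (hSU : S ⊆ U) (g : ℂ → E) :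
    IntegrableOn g (f '' S) ↔ IntegrableOn (fun x ↦ ‖deriv f x‖ ^ 2 • g (f x)) S := by
  rw [integrableOn_image_iff_integrableOn_abs_det_fderiv_smul volume hS
    (hasFDerivWithinAt_real_of_differentiableOn hU hf hSU) (hinj.mono hSU)]
  simp_rw [det_restrictScalars_toSpanSingleton, abs_of_nonneg (sq_nonneg ‖deriv f _‖)]

end ChangeOfVariables

/-! ### The inverse of a Riemann map. -/

lemma isOpen_unitDisc : IsOpen unitDisc := isOpen_ball

lemma measurableSet_unitDisc : MeasurableSet unitDisc := measurableSet_ball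

namespace IsRiemannPair

variable {Ω : Set ℂ} {φ ψ : ℂ → ℂ}

lemma right_mem (h : IsRiemannPair Ω φ ψ) {w : ℂ} (hw : w ∈ unitDisc) : ψ w ∈ Ω := by
  obtain ⟨z, hz, rfl⟩ := h.conformal.bij.surjOn hw
  rwa [h.inv.1 hz]

lemma left_mem (h : IsRiemannPair Ω φ ψ) {z : ℂ} (hz : z ∈ Ω) : φ z ∈ unitDisc :=
  h.conformal.bij.mapsTo hz

lemma left_right (h : IsRiemannPair Ω φ ψ) {w : ℂ} (hw : w ∈ unitDisc) : φ (ψ w) = w :=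
  h.inv.2 hw

lemma right_left (h : IsRiemannPair Ω φ ψ) {z : ℂ} (hz : z ∈ Ω) : ψ (φ z) = z :=
  h.inv.1 hz

lemma bijOn_right (h : IsRiemannPair Ω φ ψ) : BijOn ψ unitDisc Ω :=
  h.inv.symm.bijOn (fun _ hw ↦ h.right_mem hw) (fun _ hz ↦ h.left_mem hz)

lemma image_right (h : IsRiemannPair Ω φ ψ) : ψ '' unitDisc = Ω := h.bijOn_right.image_eq

lemma image_left (h : IsRiemannPair Ω φ ψ) : φ '' Ω = unitDisc := h.conformal.bij.image_eq

lemma deriv_left_ne_zero (h : IsRiemannPair Ω φ ψ) (hΩ : IsOpen Ω) {z : ℂ} (hz : z ∈ Ω) :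
    deriv φ z ≠ 0 :=
  deriv_ne_zero_of_injOn hΩ h.conformal.holo h.conformal.bij.injOn hz

/-- A Riemann pair asks for holomorphy of `φ` only. Since `φ' ≠ 0`, `φ` pushes the neighbourhood
filter of `ψ w` onto that of `w`, so continuity of `ψ` can be tested on `ψ ∘ φ`, which is locally
the identity. -/
lemma continuousAt_right (h : IsRiemannPair Ω φ ψ) (hΩ : IsOpen Ω) {w : ℂ} (hw : w ∈ unitDisc) :
    ContinuousAt ψ w := by
  have hz := h.right_mem hw
  have hs := (h.conformal.holo.analyticAt (hΩ.mem_nhds hz)).hasStrictDerivAt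
  have hmap := hs.map_nhds_eq (h.deriv_left_ne_zero hΩ hz)
  rw [h.left_right hw] at hmap
  rw [ContinuousAt, ← hmap, Filter.tendsto_map'_iff]
  refine Filter.Tendsto.congr' (f₁ := id) ?_ Filter.tendsto_id
  filter_upwards [hΩ.mem_nhds hz] with z hz
  simp [h.right_left hz]

lemma hasDerivAt_right (h : IsRiemannPair Ω φ ψ) (hΩ : IsOpen Ω) {w : ℂ} (hw : w ∈ unitDisc) :
    HasDerivAt ψ (deriv φ (ψ w))⁻¹ w := by
  have hz := h.right_mem hw
  refine HasDerivAt.of_local_left_inverse (h.continuousAt_right hΩ hw)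
    (h.conformal.holo.differentiableAt (hΩ.mem_nhds hz)).hasDerivAt
    (h.deriv_left_ne_zero hΩ hz) ?_
  filter_upwards [isOpen_unitDisc.mem_nhds hw] with w hw
  exact h.left_right hw

lemma deriv_right (h : IsRiemannPair Ω φ ψ) (hΩ : IsOpen Ω) {w : ℂ} (hw : w ∈ unitDisc) :
    deriv ψ w = (deriv φ (ψ w))⁻¹ := (h.hasDerivAt_right hΩ hw).deriv

lemma deriv_right_ne_zero (h : IsRiemannPair Ω φ ψ) (hΩ : IsOpen Ω) {w : ℂ}
    (hw : w ∈ unitDisc) : deriv ψ w ≠ 0 := by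
  rw [h.deriv_right hΩ hw]
  exact inv_ne_zero (h.deriv_left_ne_zero hΩ (h.right_mem hw))

lemma differentiableOn_right (h : IsRiemannPair Ω φ ψ) (hΩ : IsOpen Ω) :
    DifferentiableOn ℂ ψ unitDisc :=
  fun _ hw ↦ (h.hasDerivAt_right hΩ hw).differentiableAt.differentiableWithinAt

lemma isConformalOnto_right (h : IsRiemannPair Ω φ ψ) (hΩ : IsOpen Ω) :
    IsConformalOnto ψ unitDisc Ω :=
  ⟨h.differentiableOn_right hΩ, h.bijOn_right⟩

/-- Change of variables `z = ψ w`. -/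
lemma lintegral_eq (h : IsRiemannPair Ω φ ψ) (hΩ : IsOpen Ω) (g : ℂ → ℝ≥0∞) :
    ∫⁻ z in Ω, g z = ∫⁻ w in unitDisc, ‖deriv ψ w‖ₑ ^ 2 * g (ψ w) := by
  rw [← lintegral_image_holomorphic isOpen_unitDisc (h.differentiableOn_right hΩ)
    h.bijOn_right.injOn measurableSet_unitDisc subset_rfl, h.image_right]

end IsRiemannPair

/-! ### Automorphisms of the disc -/

/-- The Möbius transformation of the disc which maps `a` to `0`. -/
noncomputable def discMoebius (a z : ℂ) : ℂ := (z - a) / (1 - starRingEnd ℂ a * z)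

lemma mem_unitDisc {z : ℂ} : z ∈ unitDisc ↔ ‖z‖ < 1 := mem_ball_zero_iff

lemma one_sub_norm_le_norm_one_sub_conj_mul (a : ℂ) {z : ℂ} (hz : z ∈ unitDisc) :
    1 - ‖a‖ ≤ ‖1 - starRingEnd ℂ a * z‖ := by
  have h1 : ‖starRingEnd ℂ a * z‖ ≤ ‖a‖ := by
    rw [norm_mul, RCLike.norm_conj]
    exact mul_le_of_le_one_right (norm_nonneg _) (mem_unitDisc.mp hz).le
  have h2 := norm_sub_norm_le (1 : ℂ) (starRingEnd ℂ a * z)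
  rw [norm_one] at h2
  linarith

lemma one_sub_conj_mul_ne_zero {a z : ℂ} (ha : a ∈ unitDisc) (hz : z ∈ unitDisc) :
    1 - starRingEnd ℂ a * z ≠ 0 := by
  rw [← norm_pos_iff]
  linarith [one_sub_norm_le_norm_one_sub_conj_mul a hz, mem_unitDisc.mp ha]

/-- After squaring, this is positivity of `(1 - |a|²)(1 - |z|²) = |1 - āz|² - |z - a|²`. -/
lemma discMoebius_mem {a z : ℂ} (ha : a ∈ unitDisc) (hz : z ∈ unitDisc) :
    discMoebius a z ∈ unitDisc := by
  have h0 := norm_pos_iff.mpr (one_sub_conj_mul_ne_zero ha hz)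
  rw [mem_unitDisc, discMoebius, norm_div, div_lt_one h0, ← sq_lt_sq₀ (norm_nonneg _) h0.le]
  have ha' : ‖a‖ ^ 2 < 1 := by
    rw [sq_lt_one_iff₀ (norm_nonneg _)]; exact mem_unitDisc.mp ha
  have hz' : ‖z‖ ^ 2 < 1 := by
    rw [sq_lt_one_iff₀ (norm_nonneg _)]; exact mem_unitDisc.mp hz
  rw [← Complex.normSq_eq_norm_sq, Complex.normSq_apply] at ha' hz' ⊢
  rw [← Complex.normSq_eq_norm_sq, Complex.normSq_apply]
  simp
  nlinarith

lemma differentiableOn_discMoebius {a : ℂ} (ha : a ∈ unitDisc) :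
    DifferentiableOn ℂ (discMoebius a) unitDisc := by
  unfold discMoebius
  refine DifferentiableOn.div (by fun_prop) (by fun_prop) fun z hz ↦
    one_sub_conj_mul_ne_zero ha hz

lemma neg_mem_unitDisc {a : ℂ} (ha : a ∈ unitDisc) : -a ∈ unitDisc := by
  rw [mem_unitDisc, norm_neg]; exact mem_unitDisc.mp ha

lemma discMoebius_neg_discMoebius {a z : ℂ} (ha : a ∈ unitDisc) (hz : z ∈ unitDisc) :
    discMoebius (-a) (discMoebius a z) = z := by
  have h1 := one_sub_conj_mul_ne_zero ha hz
  have h2 := one_sub_conj_mul_ne_zero (neg_mem_unitDisc ha) (discMoebius_mem ha hz)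
  rw [discMoebius, div_eq_iff h2, discMoebius]
  simp only [map_neg]
  linear_combination div_mul_cancel₀ (z - a) h1

lemma zero_mem_unitDisc : (0 : ℂ) ∈ unitDisc := mem_ball_self one_pos

/-- An automorphism of the disc is the composition of a rotation and a Möbius transformation. -/
lemma exists_eqOn_discMoebius {η θ : ℂ → ℂ} (hη : DifferentiableOn ℂ η unitDisc)
    (hθ : DifferentiableOn ℂ θ unitDisc) (mη : MapsTo η unitDisc unitDisc)
    (mθ : MapsTo θ unitDisc unitDisc) (hinv : ∀ z ∈ unitDisc, θ (η z) = z) :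
    ∃ c a : ℂ, ‖c‖ = 1 ∧ a ∈ unitDisc ∧
      EqOn η (fun z ↦ discMoebius a (c * z)) unitDisc := by
  set a := η 0 with ha_def
  have ha : a ∈ unitDisc := mη zero_mem_unitDisc
  have ha' := neg_mem_unitDisc ha
  -- Moving `η 0` to the origin gives self-maps `g` and `k` of the disc which fix `0` and satisfy `k
  -- ∘ g = id`. The Schwarz lemma for both forces `|g(1/2)| = 1/2`, and its equality case makes `g`
  -- a rotation.
  set g : ℂ → ℂ := discMoebius a ∘ η with hg
  set k : ℂ → ℂ := θ ∘ discMoebius (-a) with hk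
  have mg : MapsTo g unitDisc unitDisc := fun z hz ↦ discMoebius_mem ha (mη hz)
  have mk : MapsTo k unitDisc unitDisc := fun z hz ↦ mθ (discMoebius_mem ha' hz)
  have dg : DifferentiableOn ℂ g unitDisc := (differentiableOn_discMoebius ha).comp hη mη
  have dk : DifferentiableOn ℂ k unitDisc :=
    hθ.comp (differentiableOn_discMoebius ha') fun z hz ↦ discMoebius_mem ha' hz
  have g0 : g 0 = 0 := by simp [hg, discMoebius, ← ha_def]
  have k0 : k 0 = 0 := by
    have : discMoebius (-a) 0 = a := by simp [discMoebius]
    rw [hk, Function.comp_apply, this, ha_def, hinv 0 zero_mem_unitDisc]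
  have kg : ∀ z ∈ unitDisc, k (g z) = z := by
    intro z hz
    simp only [hg, hk, Function.comp_apply]
    rw [discMoebius_neg_discMoebius ha (mη hz), hinv z hz]
  have mg' : MapsTo g (ball 0 1) (closedBall 0 1) :=
    fun z hz ↦ ball_subset_closedBall (mg hz)
  have mk' : MapsTo k (ball 0 1) (closedBall 0 1) :=
    fun z hz ↦ ball_subset_closedBall (mk hz)
  have h12 : (1 / 2 : ℂ) ∈ unitDisc := by
    rw [mem_unitDisc]; norm_num
  have hng : ‖g (1 / 2)‖ = 1 / 2 := by
    apply le_antisymm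
    · have := Complex.norm_le_norm_of_mapsTo_ball dg mg' g0 (mem_unitDisc.mp h12)
      refine this.trans (by norm_num)
    · have := Complex.norm_le_norm_of_mapsTo_ball dk mk' k0 (mem_unitDisc.mp (mg h12))
      rw [kg _ h12] at this
      refine le_trans (by norm_num) this
  have hds : ‖dslope g 0 (1 / 2)‖ = 1 := by
    rw [dslope_of_ne _ (by norm_num), slope_def_field, g0, sub_zero, norm_div, hng]
    norm_num
  have haff := Complex.affine_of_mapsTo_ball_of_norm_dslope_eq_div (R₂ := 1) dg
    (by rwa [g0]) h12 (by rw [hds]; norm_num)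
  refine ⟨dslope g 0 (1 / 2), -a, hds, ha', fun z hz ↦ ?_⟩
  have := haff hz
  simp only [g0, zero_add, sub_zero, smul_eq_mul] at this
  simp only
  rw [mul_comm, ← this, hg, Function.comp_apply, discMoebius_neg_discMoebius ha (mη hz)]

/-- The explicit form of the automorphism keeps the denominator at least `1 - |a|`. The `4` is a
crude bound of the numerator in the quotient rule, each of its two terms being at most `2`. -/
lemma exists_norm_deriv_le_of_automorphism {η θ : ℂ → ℂ} (hη : DifferentiableOn ℂ η unitDisc)
    (hθ : DifferentiableOn ℂ θ unitDisc) (mη : MapsTo η unitDisc unitDisc)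
    (mθ : MapsTo θ unitDisc unitDisc) (hinv : ∀ z ∈ unitDisc, θ (η z) = z) :
    ∃ C : ℝ≥0, ∀ z ∈ unitDisc, ‖deriv η z‖ ≤ C := by
  obtain ⟨c, a, hc, ha, heq⟩ := exists_eqOn_discMoebius hη hθ mη mθ hinv
  have ha1 : 0 < 1 - ‖a‖ := by linarith [mem_unitDisc.mp ha]
  refine ⟨⟨4 / (1 - ‖a‖) ^ 2, by positivity⟩, fun z hz ↦ ?_⟩
  have hcz : c * z ∈ unitDisc := by
    rw [mem_unitDisc, norm_mul, hc, one_mul]; exact mem_unitDisc.mp hz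
  have hd : HasDerivAt (fun z ↦ discMoebius a (c * z))
      ((c * (1 - starRingEnd ℂ a * (c * z)) - (c * z - a) * (-(starRingEnd ℂ a * c))) /
        (1 - starRingEnd ℂ a * (c * z)) ^ 2) z := by
    have h0 : HasDerivAt (fun z ↦ c * z) c z := by simpa using (hasDerivAt_id z).const_mul c
    have h1 : HasDerivAt (fun z ↦ c * z - a) c z := h0.sub_const a
    have h2 : HasDerivAt (fun z ↦ 1 - starRingEnd ℂ a * (c * z)) (-(starRingEnd ℂ a * c)) z :=
      (h0.const_mul (starRingEnd ℂ a)).const_sub 1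
    exact h1.div h2 (one_sub_conj_mul_ne_zero ha hcz)
  rw [(heq.eventuallyEq_of_mem (isOpen_unitDisc.mem_nhds hz)).deriv_eq, hd.deriv, norm_div,
    norm_pow]
  have hle := one_sub_norm_le_norm_one_sub_conj_mul a hcz
  have hna := (mem_unitDisc.mp ha).le
  have hncz := (mem_unitDisc.mp hcz).le
  have hconj : ‖starRingEnd ℂ a‖ = ‖a‖ := RCLike.norm_conj a
  have n1 : ‖1 - starRingEnd ℂ a * (c * z)‖ ≤ 2 := by
    refine (norm_sub_le _ _).trans ?_
    rw [norm_mul, hconj, norm_one]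
    nlinarith [norm_nonneg a, norm_nonneg (c * z)]
  have n2 : ‖c * z - a‖ ≤ 2 := (norm_sub_le _ _).trans (by linarith)
  have n3 : ‖c * (1 - starRingEnd ℂ a * (c * z)) - (c * z - a) * (-(starRingEnd ℂ a * c))‖ ≤ 4 := by
    refine (norm_sub_le _ _).trans ?_
    rw [norm_mul, norm_mul, norm_neg, norm_mul, hc, hconj]
    nlinarith [norm_nonneg a, norm_nonneg (c * z - a)]
  change _ ≤ 4 / (1 - ‖a‖) ^ 2
  gcongr

/-- Regularity does not depend on the Riemann map: `ψ = ψ₀ ∘ η` with `η` an automorphism of the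
disc. Of the factor `|η'|^α`, two powers serve as Jacobian, and the other `α - 2 > 0` are bounded.
-/
theorem IsConformalRegular.lintegral_deriv_lt_top {α : ℝ} {Ω : Set ℂ} {φ ψ : ℂ → ℂ}
    (hΩ : IsConformalRegular α Ω) (h : IsRiemannPair Ω φ ψ) :
    ∫⁻ w in unitDisc, ‖deriv ψ w‖ₑ ^ α < ⊤ := by
  obtain ⟨hα, ⟨hO, -⟩, φ₀, ψ₀, h₀, hfin⟩ := hΩ
  set η := φ₀ ∘ ψ with hη
  set θ := φ ∘ ψ₀ with hθ
  have mη : MapsTo η unitDisc unitDisc := fun z hz ↦ h₀.left_mem (h.right_mem hz)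
  have mθ : MapsTo θ unitDisc unitDisc := fun z hz ↦ h.left_mem (h₀.right_mem hz)
  have dη : DifferentiableOn ℂ η unitDisc :=
    h₀.conformal.holo.comp (h.differentiableOn_right hO) fun z hz ↦ h.right_mem hz
  have dθ : DifferentiableOn ℂ θ unitDisc :=
    h.conformal.holo.comp (h₀.differentiableOn_right hO) fun z hz ↦ h₀.right_mem hz
  have hθη : ∀ z ∈ unitDisc, θ (η z) = z := fun z hz ↦ by
    simp only [hη, hθ, Function.comp_apply, h₀.right_left (h.right_mem hz), h.left_right hz]
  have hηθ : ∀ z ∈ unitDisc, η (θ z) = z := fun z hz ↦ by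
    simp only [hη, hθ, Function.comp_apply, h.right_left (h₀.right_mem hz), h₀.left_right hz]
  have hbij : BijOn η unitDisc unitDisc := InvOn.bijOn ⟨hθη, hηθ⟩ mη mθ
  obtain ⟨C, hC⟩ := exists_norm_deriv_le_of_automorphism dη dθ mη mθ hθη
  have hderiv : ∀ w ∈ unitDisc, deriv ψ w = deriv ψ₀ (η w) * deriv η w := by
    intro w hw
    have hcomp : EqOn ψ (ψ₀ ∘ η) unitDisc := fun z hz ↦ by
      simp only [hη, Function.comp_apply, h₀.right_left (h.right_mem hz)]
    rw [(hcomp.eventuallyEq_of_mem (isOpen_unitDisc.mem_nhds hw)).deriv_eq]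
    exact deriv_comp w (h₀.hasDerivAt_right hO (mη hw)).differentiableAt
      (dη.differentiableAt (isOpen_unitDisc.mem_nhds hw))
  calc ∫⁻ w in unitDisc, ‖deriv ψ w‖ₑ ^ α
      ≤ ∫⁻ w in unitDisc, (C : ℝ≥0∞) ^ (α - 2) * (‖deriv η w‖ₑ ^ 2 * ‖deriv ψ₀ (η w)‖ₑ ^ α) := by
        refine setLIntegral_mono' measurableSet_unitDisc fun w hw ↦ ?_
        rw [hderiv w hw, enorm_mul, ENNReal.mul_rpow_of_nonneg _ _ (by linarith)]
        have h1 : ‖deriv η w‖ₑ ^ α = ‖deriv η w‖ₑ ^ (α - 2) * ‖deriv η w‖ₑ ^ 2 := by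
          rw [← ENNReal.rpow_two, ← ENNReal.rpow_add_of_nonneg _ _ (by linarith) (by norm_num)]
          congr 1; ring
        have h2 : ‖deriv η w‖ₑ ≤ C := by
          rw [← enorm_norm, Real.enorm_eq_ofReal (norm_nonneg _)]
          exact ENNReal.ofReal_le_of_le_toReal (hC w hw)
        rw [h1]
        calc ‖deriv ψ₀ (η w)‖ₑ ^ α * (‖deriv η w‖ₑ ^ (α - 2) * ‖deriv η w‖ₑ ^ 2)
            = ‖deriv η w‖ₑ ^ (α - 2) * (‖deriv η w‖ₑ ^ 2 * ‖deriv ψ₀ (η w)‖ₑ ^ α) := by ring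
          _ ≤ _ := by
            gcongr
    _ = (C : ℝ≥0∞) ^ (α - 2) * ∫⁻ w in unitDisc, ‖deriv ψ₀ w‖ₑ ^ α := by
        rw [lintegral_const_mul' _ _ (ENNReal.rpow_ne_top_of_nonneg (by linarith) (by simp)),
          ← lintegral_image_holomorphic isOpen_unitDisc dη hbij.injOn measurableSet_unitDisc
          subset_rfl (fun z ↦ ‖deriv ψ₀ z‖ₑ ^ α), hbij.image_eq]
    _ < ⊤ := ENNReal.mul_lt_top
        (ENNReal.rpow_lt_top_of_nonneg (by linarith) (by simp)) hfin

/-! ### The chain rule for weak gradients under conformal maps -/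

lemma MeasureTheory.LocallyIntegrableOn.integrable_mul_of_tsupport_subset {U : Set ℂ} {f h : ℂ → ℝ}
    (hU : IsOpen U) (hf : LocallyIntegrableOn f U) (hh : Continuous h) (hc : HasCompactSupport h)
    (hs : tsupport h ⊆ U) : Integrable (fun z ↦ f z * h z) := by
  have h1 := (locallyIntegrableOn_iff hU.isLocallyClosed).mp hf _ hs hc
  have h2 := IntegrableOn.mul_continuousOn h1 hh.continuousOn hc
  exact h2.integrable_of_forall_notMem_eq_zero fun x hx ↦ by
    rw [image_eq_zero_of_notMem_tsupport hx, mul_zero]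

lemma MeasureTheory.LocallyIntegrableOn.inner_const {U : Set ℂ} {G : ℂ → ℂ} (hU : IsOpen U)
    (hG : LocallyIntegrableOn G U) (v : ℂ) : LocallyIntegrableOn (fun z ↦ inner ℝ (G z) v) U := by
  rw [locallyIntegrableOn_iff hU.isLocallyClosed] at hG ⊢
  exact fun K hK hKc ↦ (hG K hK hKc).inner_const v

/-- The function `(η ∘ φ) * k` on `Ω`, extended by zero. -/
noncomputable def testPullback (Ω : Set ℂ) (φ : ℂ → ℂ) (η k : ℂ → ℝ) : ℂ → ℝ :=
  indicator Ω fun z ↦ η (φ z) * k z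

namespace IsRiemannPair

variable {Ω : Set ℂ} {φ ψ : ℂ → ℂ} {η k : ℂ → ℝ}

lemma isCompact_image_right (h : IsRiemannPair Ω φ ψ) (hΩ : IsOpen Ω) {K : Set ℂ}
    (hK : IsCompact K) (hKD : K ⊆ unitDisc) : IsCompact (ψ '' K) :=
  hK.image_of_continuousOn ((h.differentiableOn_right hΩ).continuousOn.mono hKD)

lemma image_right_subset (h : IsRiemannPair Ω φ ψ) {K : Set ℂ} (hKD : K ⊆ unitDisc) :
    ψ '' K ⊆ Ω := by
  rintro _ ⟨w, hw, rfl⟩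
  exact h.right_mem (hKD hw)

lemma testPullback_eq_zero (h : IsRiemannPair Ω φ ψ) {z : ℂ} (hz : z ∉ ψ '' tsupport η) :
    testPullback Ω φ η k z = 0 := by
  by_cases hzΩ : z ∈ Ω
  · rw [testPullback, indicator_of_mem hzΩ, image_eq_zero_of_notMem_tsupport (f := η), zero_mul]
    exact fun h' ↦ hz ⟨_, h', h.right_left hzΩ⟩
  · exact indicator_of_notMem hzΩ _

lemma hasCompactSupport_testPullback (h : IsRiemannPair Ω φ ψ) (hΩ : IsOpen Ω)
    (hc : HasCompactSupport η) (hs : tsupport η ⊆ unitDisc) :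
    HasCompactSupport (testPullback Ω φ η k) :=
  HasCompactSupport.intro (h.isCompact_image_right hΩ hc hs) fun _ hz ↦ h.testPullback_eq_zero hz

lemma tsupport_testPullback_subset (h : IsRiemannPair Ω φ ψ) (hΩ : IsOpen Ω)
    (hc : HasCompactSupport η) (hs : tsupport η ⊆ unitDisc) :
    tsupport (testPullback Ω φ η k) ⊆ Ω := by
  refine (closure_minimal ?_ (h.isCompact_image_right hΩ hc hs).isClosed).trans
    (h.image_right_subset hs)
  intro z hz
  by_contra hz'
  exact hz (h.testPullback_eq_zero hz')

lemma testPullback_eventuallyEq (hΩ : IsOpen Ω) {z : ℂ} (hz : z ∈ Ω) :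
    testPullback Ω φ η k =ᶠ[nhds z] fun z ↦ η (φ z) * k z := by
  filter_upwards [hΩ.mem_nhds hz] with x hx
  exact indicator_of_mem hx _

/-- Extension by zero is harmless: the function vanishes off the compact set `ψ '' tsupport η`,
which lies inside `Ω`. -/
lemma contDiff_testPullback (h : IsRiemannPair Ω φ ψ) (hΩ : IsOpen Ω) (hη : ContDiff ℝ ∞ η)
    (hc : HasCompactSupport η) (hs : tsupport η ⊆ unitDisc) (hk : ContDiffOn ℝ ∞ k Ω) :
    ContDiff ℝ ∞ (testPullback Ω φ η k) := by
  rw [contDiff_iff_contDiffAt]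
  intro z
  by_cases hz : z ∈ Ω
  · have hφ : ContDiffAt ℝ ∞ φ z :=
      ((h.conformal.holo.contDiffOn hΩ).restrict_scalars ℝ).contDiffAt (hΩ.mem_nhds hz)
    exact ((hη.contDiffAt.comp z hφ).mul (hk.contDiffAt (hΩ.mem_nhds hz))).congr_of_eventuallyEq
      (testPullback_eventuallyEq hΩ hz)
  · have hz' : z ∉ ψ '' tsupport η := fun h' ↦ hz (h.image_right_subset hs h')
    refine (contDiffAt_const (c := (0 : ℝ))).congr_of_eventuallyEq ?_
    filter_upwards [(h.isCompact_image_right hΩ hc hs).isClosed.isOpen_compl.mem_nhds hz'] with x hx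
    exact h.testPullback_eq_zero hx

lemma fderiv_testPullback (h : IsRiemannPair Ω φ ψ) (hΩ : IsOpen Ω) (hη : ContDiff ℝ ∞ η)
    {z : ℂ} (hz : z ∈ Ω) {k' : ℂ →L[ℝ] ℝ} (hk : HasFDerivAt k k' z) (u : ℂ) :
    fderiv ℝ (testPullback Ω φ η k) z u =
      fderiv ℝ η (φ z) (deriv φ z * u) * k z + η (φ z) * k' u := by
  rw [(testPullback_eventuallyEq hΩ hz).fderiv_eq]
  have h1 : HasFDerivAt φ ((ContinuousLinearMap.toSpanSingleton ℂ (deriv φ z)).restrictScalars ℝ)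
      z := (h.conformal.holo.differentiableAt
        (hΩ.mem_nhds hz)).hasDerivAt.hasFDerivAt.restrictScalars ℝ
  have h2 : HasFDerivAt η (fderiv ℝ η (φ z)) (φ z) :=
    (hη.differentiable (by simp) _).hasFDerivAt
  have h3 := (h2.comp z h1).mul hk
  have h4 : HasFDerivAt (fun z ↦ η (φ z) * k z) _ z := h3
  rw [h4.fderiv]
  simp
  ring_nf

end IsRiemannPair

section

variable {Ω : Set ℂ} {φ ψ : ℂ → ℂ}

/-- The components of the conjugate of a holomorphic function, here `conj (φ' * conj v)`, form a
divergence free vector field. -/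
lemma fderiv_testPullback_add (h : IsRiemannPair Ω φ ψ) (hΩ : IsOpen Ω) {η : ℂ → ℝ}
    (hη : ContDiff ℝ ∞ η) (v : ℂ) {z : ℂ} (hz : z ∈ Ω) :
    fderiv ℝ (testPullback Ω φ η fun z ↦ (deriv φ z * starRingEnd ℂ v).re) z 1 +
      fderiv ℝ (testPullback Ω φ η fun z ↦ -(deriv φ z * starRingEnd ℂ v).im) z Complex.I =
    ‖deriv φ z‖ ^ 2 * fderiv ℝ η (φ z) v := by
  have hg : HasDerivAt (fun z ↦ deriv φ z * starRingEnd ℂ v)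
      (deriv (deriv φ) z * starRingEnd ℂ v) z :=
    (((h.conformal.holo.deriv hΩ).differentiableAt (hΩ.mem_nhds hz)).hasDerivAt).mul_const _
  have hg' := hg.hasFDerivAt.restrictScalars ℝ
  have hre : HasFDerivAt (fun z ↦ (deriv φ z * starRingEnd ℂ v).re) _ z :=
    Complex.reCLM.hasFDerivAt.comp z hg'
  have him : HasFDerivAt (fun z ↦ -(deriv φ z * starRingEnd ℂ v).im) _ z :=
    (Complex.imCLM.hasFDerivAt.comp z hg').neg
  rw [h.fderiv_testPullback hΩ hη hz hre, h.fderiv_testPullback hΩ hη hz him]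
  set L := fderiv ℝ η (φ z)
  set d := deriv φ z
  -- The two real coefficients are the components of `conj d * v`, whose product with `d` is `|d|²
  -- v`.
  have key : (‖d‖ ^ 2 : ℝ) • v =
      ((d * starRingEnd ℂ v).re) • (d * 1) + (-(d * starRingEnd ℂ v).im) • (d * Complex.I) := by
    rw [← Complex.normSq_eq_norm_sq, Complex.normSq_apply]
    apply Complex.ext <;> simp <;> ring
  have h2 : ‖d‖ ^ 2 * L v = (d * starRingEnd ℂ v).re * L (d * 1) +
      (-(d * starRingEnd ℂ v).im) * L (d * Complex.I) := by
    rw [← smul_eq_mul, ← L.map_smul, key, L.map_add, L.map_smul, L.map_smul, smul_eq_mul,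
      smul_eq_mul]
  -- The terms in which `η` is not differentiated carry the factor `Re g' - Im (i g') = 0`, with `g
  -- = φ' * conj v`.
  rw [h2]
  simp
  ring

/-- A test function `η` on the disc and a direction `v` yield two test functions on `Ω`: `η ∘ φ`
times the components `a`, `b` of `conj φ' * v`. Testing the gradient of `f` with them in the
directions `1` and `i` and adding, the divergence of `(a, b)` drops out, and what remains is the
identity on the disc after the change of variables by `φ`. -/
theorem HasWeakGradient.comp_conformal (h : IsRiemannPair Ω φ ψ) (hΩ : IsOpen Ω) {f : ℂ → ℝ}
    {G : ℂ → ℂ} (hf : HasWeakGradient Ω f G) :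
    HasWeakGradient unitDisc (f ∘ ψ) (fun w ↦ starRingEnd ℂ (deriv ψ w) * G (ψ w)) := by
  have hdφ : ContinuousOn (deriv φ) Ω := (h.conformal.holo.deriv hΩ).continuousOn
  have hcompact : ∀ K ⊆ unitDisc, K = φ '' (ψ '' K) := by
    intro K hK
    rw [image_image]
    ext w
    constructor
    · exact fun hw ↦ ⟨w, hw, h.left_right (hK hw)⟩
    · rintro ⟨w', hw', rfl⟩
      simpa only [h.left_right (hK hw')] using hw'
  have hdψ : ∀ z ∈ Ω, deriv ψ (φ z) = (deriv φ z)⁻¹ := fun z hz ↦ by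
    rw [h.deriv_right hΩ (h.left_mem hz), h.right_left hz]
  have hconj : ∀ z ∈ Ω, ∀ x : ℂ, (‖deriv φ z‖ ^ 2 : ℝ) • (starRingEnd ℂ (deriv φ z)⁻¹ * x) =
      deriv φ z * x := by
    intro z hz x
    have h0 : starRingEnd ℂ (deriv φ z) ≠ 0 :=
      (map_ne_zero _).mpr (h.deriv_left_ne_zero hΩ hz)
    rw [Complex.real_smul, Complex.ofReal_pow, ← Complex.mul_conj', map_inv₀]
    field_simp
  have hint := hf.locInt
  have hintG := hf.locInt_grad
  rw [locallyIntegrableOn_iff hΩ.isLocallyClosed] at hint hintG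
  refine ⟨?_, ?_, ?_⟩
  · rw [locallyIntegrableOn_iff isOpen_unitDisc.isLocallyClosed]
    intro K hK hKc
    have hK' := h.image_right_subset hK
    have hKc' := h.isCompact_image_right hΩ hKc hK
    rw [hcompact K hK, integrableOn_image_holomorphic_iff hΩ h.conformal.holo
      h.conformal.bij.injOn hKc'.measurableSet hK']
    have := IntegrableOn.continuousOn_mul (g := fun z ↦ ‖deriv φ z‖ ^ 2)
      ((hdφ.mono hK').norm.pow 2) (hint _ hK' hKc') hKc'
    refine this.congr_fun (fun z hz ↦ ?_) hKc'.measurableSet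
    simp only [Function.comp_apply, smul_eq_mul, h.right_left (hK' hz)]
  · rw [locallyIntegrableOn_iff isOpen_unitDisc.isLocallyClosed]
    intro K hK hKc
    have hK' := h.image_right_subset hK
    have hKc' := h.isCompact_image_right hΩ hKc hK
    rw [hcompact K hK, integrableOn_image_holomorphic_iff hΩ h.conformal.holo
      h.conformal.bij.injOn hKc'.measurableSet hK']
    have := IntegrableOn.continuousOn_mul (hdφ.mono hK') (hintG _ hK' hKc') hKc'
    refine this.congr_fun (fun z hz ↦ ?_) hKc'.measurableSet
    simp only
    rw [hdψ z (hK' hz), h.right_left (hK' hz), hconj z (hK' hz)]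
  · intro η hη hc hs v
    set a : ℂ → ℝ := fun z ↦ (deriv φ z * starRingEnd ℂ v).re with ha
    set b : ℂ → ℝ := fun z ↦ -(deriv φ z * starRingEnd ℂ v).im with hb
    have hg : ContDiffOn ℝ ∞ (fun z ↦ deriv φ z * starRingEnd ℂ v) Ω :=
      (((h.conformal.holo.deriv hΩ).mul_const _).contDiffOn hΩ).restrict_scalars ℝ
    have hac : ContDiffOn ℝ ∞ a Ω := Complex.reCLM.contDiff.comp_contDiffOn hg
    have hbc : ContDiffOn ℝ ∞ b Ω := (Complex.imCLM.contDiff.comp_contDiffOn hg).neg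
    have integ : ∀ k : ℂ → ℝ, ContDiffOn ℝ ∞ k Ω → ∀ u : ℂ,
        IntegrableOn (fun z ↦ f z * fderiv ℝ (testPullback Ω φ η k) z u) Ω ∧
        IntegrableOn (fun z ↦ inner ℝ (G z) u * testPullback Ω φ η k z) Ω := by
      intro k hk u
      have h1 := h.contDiff_testPullback hΩ hη hc hs hk
      have h2 := h.hasCompactSupport_testPullback (k := k) hΩ hc hs
      have h3 := h.tsupport_testPullback_subset (k := k) hΩ hc hs
      refine ⟨(hf.locInt.integrable_mul_of_tsupport_subset hΩ ?_ (h2.fderiv_apply ℝ u)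
        ((tsupport_fderiv_apply_subset ℝ u).trans h3)).integrableOn,
        ((hf.locInt_grad.inner_const hΩ u).integrable_mul_of_tsupport_subset hΩ h1.continuous h2
        h3).integrableOn⟩
      exact (h1.continuous_fderiv (by simp)).clm_apply continuous_const
    have byA := hf.byParts _ (h.contDiff_testPullback hΩ hη hc hs hac)
      (h.hasCompactSupport_testPullback hΩ hc hs) (h.tsupport_testPullback_subset hΩ hc hs) 1
    have byB := hf.byParts _ (h.contDiff_testPullback hΩ hη hc hs hbc)
      (h.hasCompactSupport_testPullback hΩ hc hs) (h.tsupport_testPullback_subset hΩ hc hs)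
      Complex.I
    have hsum := congrArg₂ (· + ·) byA byB
    rw [← integral_add (integ a hac 1).1 (integ b hbc Complex.I).1, ← neg_add,
      ← integral_add (integ a hac 1).2 (integ b hbc Complex.I).2] at hsum
    rw [← h.image_left, integral_image_holomorphic hΩ h.conformal.holo h.conformal.bij.injOn
      hΩ.measurableSet subset_rfl, integral_image_holomorphic hΩ h.conformal.holo
      h.conformal.bij.injOn hΩ.measurableSet subset_rfl]
    convert hsum using 1
    · refine setIntegral_congr_fun hΩ.measurableSet fun z hz ↦ ?_
      simp only [Function.comp_apply, h.right_left hz]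
      rw [← mul_add, fderiv_testPullback_add h hΩ hη v hz]
      ring
    · congr 1
      refine setIntegral_congr_fun hΩ.measurableSet fun z hz ↦ ?_
      have e1 : ∀ k : ℂ → ℝ, testPullback Ω φ η k z = η (φ z) * k z :=
        fun k ↦ indicator_of_mem hz _
      simp only [h.right_left hz, hdψ z hz, e1]
      rw [← mul_assoc, ← real_inner_smul_left, hconj z hz]
      simp only [Complex.inner, ha, hb]
      simp
      ring

end

/-! ### The Riesz potential estimate -/

lemma lintegral_comp_homothety (F : ℂ → ℝ≥0∞) (hF : Measurable F) (z : ℂ) {t : ℝ} (ht : 0 < t) :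
    ∫⁻ w, F (z + t • (w - z)) = ENNReal.ofReal (t ^ (-2 : ℝ)) * ∫⁻ y, F y := by
  rw [lintegral_sub_right_eq_self (fun w ↦ F (z + t • w)) z]
  have h1 : Measurable fun x ↦ F (z + x) := hF.comp (measurable_const_add z)
  have h2 : Measurable fun w : ℂ ↦ t • w := measurable_const_smul t
  rw [← lintegral_map (f := fun x ↦ F (z + x)) h1 h2, Measure.map_addHaar_smul _ ht.ne',
    lintegral_smul_measure, lintegral_add_left_eq_self, smul_eq_mul, Complex.finrank_real_complex,
    abs_of_nonneg (by positivity), Real.rpow_neg ht.le]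
  norm_num

lemma enorm_sub_le_lintegral_fderiv {u : ℂ → ℝ} (hu : ContDiff ℝ 1 u) (z w : ℂ) :
    ‖u z - u w‖ₑ ≤ ∫⁻ t in Ioo (0 : ℝ) 1, ‖fderiv ℝ u (z + t • (w - z))‖ₑ * ‖w - z‖ₑ := by
  have hcont : Continuous fun t : ℝ ↦ fderiv ℝ u (z + t • (w - z)) (w - z) :=
    ((hu.continuous_fderiv one_ne_zero).comp (by fun_prop)).clm_apply continuous_const
  have hd : ∀ t ∈ uIcc (0 : ℝ) 1, HasDerivAt (fun t : ℝ ↦ u (z + t • (w - z)))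
      (fderiv ℝ u (z + t • (w - z)) (w - z)) t := by
    intro t _
    have h1 : HasDerivAt (fun t : ℝ ↦ z + t • (w - z)) (w - z) t := by
      simpa using ((hasDerivAt_id t).smul_const (w - z)).const_add z
    exact ((hu.differentiable one_ne_zero _).hasFDerivAt).comp_hasDerivAt t h1
  have h := intervalIntegral.integral_eq_sub_of_hasDerivAt hd (hcont.intervalIntegrable 0 1)
  simp only [one_smul, zero_smul, add_zero, add_sub_cancel] at h
  rw [← enorm_neg, neg_sub, ← h, intervalIntegral.integral_of_le zero_le_one,
    integral_Ioc_eq_integral_Ioo]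
  refine (enorm_integral_le_lintegral_enorm _).trans (lintegral_mono fun t ↦ ?_)
  exact ContinuousLinearMap.le_opENorm _ _

lemma lintegral_Ioi_rpow_neg_three {a : ℝ} (ha : 0 < a) :
    ∫⁻ t in Ioi a, ENNReal.ofReal (t ^ (-3 : ℝ)) = ENNReal.ofReal (a ^ (-2 : ℝ) / 2) := by
  rw [← ofReal_integral_eq_lintegral_ofReal (integrableOn_Ioi_rpow_of_lt (by norm_num) ha),
    integral_Ioi_rpow_of_lt (by norm_num) ha]
  · congr 1
    norm_num
  · filter_upwards [self_mem_ae_restrict measurableSet_Ioi] with t ht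
    exact Real.rpow_nonneg (ha.trans ht).le _

/-- On a ball of radius at most `1`, the mean oscillation of a `C¹` function at a point is
controlled by the Riesz potential of its gradient. -/
theorem lintegral_enorm_sub_le_rieszPotential {u : ℂ → ℝ} (hu : ContDiff ℝ 1 u) {R : ℝ}
    (hR : R ≤ 1) {z : ℂ} (hz : z ∈ ball (0 : ℂ) R) :
    ∫⁻ w in ball (0 : ℂ) R, ‖u z - u w‖ₑ ≤
      2 * ∫⁻ y in ball (0 : ℂ) R, ‖fderiv ℝ u y‖ₑ * ‖y - z‖ₑ⁻¹ := by
  set g : ℂ → ℝ≥0∞ := fun y ↦ ‖fderiv ℝ u y‖ₑ with hg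
  have hgc : Continuous g := (hu.continuous_fderiv one_ne_zero).enorm
  -- For `y = z + t(w - z)` with `z`, `w` in a ball of radius at most `1` one has `|y - z| < 2t`;
  -- the cutoff records this. Passing from `w` to `y` costs `t⁻²` for the Jacobian and `t⁻¹` for `|w
  -- - z| = |y - z|/t`.
  set k : ℝ → ℂ → ℝ≥0∞ := fun t y ↦ if ‖y - z‖ < 2 * t then g y * ‖y - z‖ₑ else 0 with hk
  have hkm : Measurable (Function.uncurry k) := by
    refine Measurable.ite (measurableSet_lt (by fun_prop) (by fun_prop)) ?_ measurable_const
    exact (hgc.measurable.comp measurable_snd).mul (by fun_prop)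
  have hkm' : ∀ t, Measurable (k t) := fun t ↦ hkm.comp (measurable_const.prodMk measurable_id)
  have step : ∀ t ∈ Ioo (0 : ℝ) 1,
      ∫⁻ w in ball (0 : ℂ) R, g (z + t • (w - z)) * ‖w - z‖ₑ ≤
        ∫⁻ y in ball (0 : ℂ) R, ENNReal.ofReal (t ^ (-3 : ℝ)) * k t y := by
    intro t ht
    set F : ℂ → ℝ≥0∞ := fun y ↦ ENNReal.ofReal (t ^ (-1 : ℝ)) * (ball (0 : ℂ) R).indicator (k t) y
      with hF
    have hFm : Measurable F := ((hkm' t).indicator measurableSet_ball).const_mul _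
    calc ∫⁻ w in ball (0 : ℂ) R, g (z + t • (w - z)) * ‖w - z‖ₑ
        ≤ ∫⁻ w in ball (0 : ℂ) R, F (z + t • (w - z)) := by
          refine setLIntegral_mono' measurableSet_ball fun w hw ↦ ?_
          have hmem : z + t • (w - z) ∈ ball (0 : ℂ) R :=
            (convex_ball (0 : ℂ) R).add_smul_sub_mem hz hw ⟨ht.1.le, ht.2.le⟩
          have hlt : ‖z + t • (w - z) - z‖ < 2 * t := by
            rw [add_sub_cancel_left, norm_smul, Real.norm_of_nonneg ht.1.le, mul_comm]
            refine mul_lt_mul_of_pos_right ?_ ht.1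
            refine (norm_sub_le _ _).trans_lt ?_
            rw [mem_ball_zero_iff] at hz hw
            linarith
          rw [hF]
          simp only
          rw [indicator_of_mem hmem, hk]
          simp only
          rw [if_pos hlt, add_sub_cancel_left, enorm_smul, Real.enorm_of_nonneg ht.1.le]
          have : ENNReal.ofReal (t ^ (-1 : ℝ)) * ENNReal.ofReal t = 1 := by
            rw [← ENNReal.ofReal_mul (Real.rpow_nonneg ht.1.le _), Real.rpow_neg_one,
              inv_mul_cancel₀ ht.1.ne', ENNReal.ofReal_one]
          calc g (z + t • (w - z)) * ‖w - z‖ₑ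
              = (ENNReal.ofReal (t ^ (-1 : ℝ)) * ENNReal.ofReal t) *
                  (g (z + t • (w - z)) * ‖w - z‖ₑ) := by rw [this, one_mul]
            _ ≤ _ := le_of_eq (by ring)
      _ ≤ ∫⁻ w, F (z + t • (w - z)) := setLIntegral_le_lintegral _ _
      _ = ENNReal.ofReal (t ^ (-2 : ℝ)) * ∫⁻ y, F y := lintegral_comp_homothety F hFm z ht.1
      _ = ∫⁻ y in ball (0 : ℂ) R, ENNReal.ofReal (t ^ (-3 : ℝ)) * k t y := by
          rw [hF, lintegral_const_mul _ ((hkm' t).indicator measurableSet_ball),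
            lintegral_indicator measurableSet_ball, lintegral_const_mul _ (hkm' t), ← mul_assoc,
            ← ENNReal.ofReal_mul (Real.rpow_nonneg ht.1.le _), ← Real.rpow_add ht.1]
          norm_num
  -- The integral of `t⁻³` over `t > |y - z|/2` is `2/|y - z|²`; one factor `|y - z|` cancels and
  -- the Riesz kernel is left.
  have inner : ∀ y, ∫⁻ t in Ioo (0 : ℝ) 1, ENNReal.ofReal (t ^ (-3 : ℝ)) * k t y ≤
      2 * (g y * ‖y - z‖ₑ⁻¹) := by
    intro y
    rcases eq_or_ne y z with rfl | hyz
    · simp [hk]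
    have hpos : 0 < ‖y - z‖ := norm_pos_iff.mpr (sub_ne_zero.mpr hyz)
    calc ∫⁻ t in Ioo (0 : ℝ) 1, ENNReal.ofReal (t ^ (-3 : ℝ)) * k t y
        ≤ ∫⁻ t, (Ioi (‖y - z‖ / 2)).indicator
            (fun t ↦ ENNReal.ofReal (t ^ (-3 : ℝ)) * (g y * ‖y - z‖ₑ)) t := by
          refine (setLIntegral_le_lintegral _ _).trans (lintegral_mono fun t ↦ ?_)
          simp only [hk]
          split_ifs with h
          · rw [indicator_of_mem (by rw [mem_Ioi]; linarith)]
          · simp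
      _ = ENNReal.ofReal ((‖y - z‖ / 2) ^ (-2 : ℝ) / 2) * (g y * ‖y - z‖ₑ) := by
          rw [lintegral_indicator measurableSet_Ioi, lintegral_mul_const _ (by fun_prop),
            lintegral_Ioi_rpow_neg_three (by positivity)]
      _ ≤ 2 * (g y * ‖y - z‖ₑ⁻¹) := by
          have e : ENNReal.ofReal ((‖y - z‖ / 2) ^ (-2 : ℝ) / 2) * ‖y - z‖ₑ =
              2 * ‖y - z‖ₑ⁻¹ := by
            rw [← ofReal_norm, ← ENNReal.ofReal_inv_of_pos hpos,
              ← ENNReal.ofReal_mul (by positivity), ← ENNReal.ofReal_ofNat 2,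
              ← ENNReal.ofReal_mul (by norm_num), Real.rpow_neg (by positivity), Real.rpow_two]
            congr 1
            field_simp
          calc _ = g y * (ENNReal.ofReal ((‖y - z‖ / 2) ^ (-2 : ℝ) / 2) * ‖y - z‖ₑ) := by ring
            _ = g y * (2 * ‖y - z‖ₑ⁻¹) := by rw [e]
            _ ≤ _ := le_of_eq (by ring)
  have hm1 : Measurable (Function.uncurry fun (w : ℂ) (t : ℝ) ↦
      g (z + t • (w - z)) * ‖w - z‖ₑ) := by
    refine Measurable.mul ?_ (by fun_prop : Measurable fun p : ℂ × ℝ ↦ ‖p.1 - z‖ₑ)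
    exact (hgc.comp (by fun_prop : Continuous fun p : ℂ × ℝ ↦ z + p.2 • (p.1 - z))).measurable
  have hm2 : Measurable (Function.uncurry fun (t : ℝ) (y : ℂ) ↦
      ENNReal.ofReal (t ^ (-3 : ℝ)) * k t y) := by
    refine Measurable.mul ?_ hkm
    exact ((measurable_id.pow_const (-3 : ℝ)).ennreal_ofReal).comp measurable_fst
  calc ∫⁻ w in ball (0 : ℂ) R, ‖u z - u w‖ₑ
      ≤ ∫⁻ w in ball (0 : ℂ) R, ∫⁻ t in Ioo (0 : ℝ) 1, g (z + t • (w - z)) * ‖w - z‖ₑ :=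
        lintegral_mono fun w ↦ enorm_sub_le_lintegral_fderiv hu z w
    _ = ∫⁻ t in Ioo (0 : ℝ) 1, ∫⁻ w in ball (0 : ℂ) R, g (z + t • (w - z)) * ‖w - z‖ₑ :=
        lintegral_lintegral_swap hm1.aemeasurable
    _ ≤ ∫⁻ t in Ioo (0 : ℝ) 1, ∫⁻ y in ball (0 : ℂ) R, ENNReal.ofReal (t ^ (-3 : ℝ)) * k t y :=
        setLIntegral_mono' measurableSet_Ioo step
    _ = ∫⁻ y in ball (0 : ℂ) R, ∫⁻ t in Ioo (0 : ℝ) 1, ENNReal.ofReal (t ^ (-3 : ℝ)) * k t y :=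
        lintegral_lintegral_swap hm2.aemeasurable
    _ ≤ ∫⁻ y in ball (0 : ℂ) R, 2 * (g y * ‖y - z‖ₑ⁻¹) := lintegral_mono inner
    _ = 2 * ∫⁻ y in ball (0 : ℂ) R, g y * ‖y - z‖ₑ⁻¹ :=
        lintegral_const_mul' _ _ (by simp)

/-- The integral over the disc of radius `2` of the `q`-th power of the Riesz kernel. -/
noncomputable def rieszKernelIntegral (q : ℝ) : ℝ≥0∞ :=
  ∫⁻ x in ball (0 : ℂ) 2, (‖x‖ₑ⁻¹) ^ q

lemma rieszKernelIntegral_lt_top {q : ℝ} (hq : q < 2) : rieszKernelIntegral q < ⊤ := by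
  have hint : IntegrableOn (fun x : ℂ ↦ ‖x‖ ^ (-q)) (ball (0 : ℂ) 2) := by
    refine integrableOn_ball_of_norm_le_rpow (C := 1) (α := q) (by simp) (by simpa using hq) ?_ ?_
    · filter_upwards with x
      rw [Real.norm_of_nonneg (Real.rpow_nonneg (norm_nonneg _) _), one_mul]
    · exact (measurable_norm.pow_const _).aestronglyMeasurable
  have h := hint.2
  rw [hasFiniteIntegral_iff_enorm] at h
  refine lt_of_le_of_lt (lintegral_mono_ae ?_) h
  -- The origin is discarded because `0⁻¹ = ∞` in `ℝ≥0∞`, unlike the real power there.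
  have h0 : ∀ᵐ x ∂(volume.restrict (ball (0 : ℂ) 2)), x ≠ 0 :=
    ae_restrict_of_ae (by simp [ae_iff])
  filter_upwards [h0] with x hx
  have hx' : 0 < ‖x‖ := norm_pos_iff.mpr hx
  rw [Real.enorm_of_nonneg (Real.rpow_nonneg (norm_nonneg _) _), ← ofReal_norm,
    ← ENNReal.ofReal_inv_of_pos hx', ENNReal.ofReal_rpow_of_pos (inv_pos.mpr hx'),
    Real.inv_rpow hx'.le, Real.rpow_neg hx'.le]

lemma lintegral_inv_enorm_sub_rpow_le (q : ℝ) {R : ℝ} (hR : R ≤ 1) {z : ℂ}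
    (hz : z ∈ ball (0 : ℂ) R) :
    ∫⁻ y in ball (0 : ℂ) R, (‖y - z‖ₑ⁻¹) ^ q ≤ rieszKernelIntegral q := by
  rw [← lintegral_indicator measurableSet_ball, rieszKernelIntegral,
    ← lintegral_indicator measurableSet_ball, ← lintegral_sub_right_eq_self ((ball (0 : ℂ) 2).indicator _) z]
  refine lintegral_mono fun y ↦ ?_
  by_cases hy : y ∈ ball (0 : ℂ) R
  · rw [indicator_of_mem hy, indicator_of_mem]
    rw [mem_ball_zero_iff] at *
    exact (norm_sub_le _ _).trans_lt (by linarith)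
  · rw [indicator_of_notMem hy]; exact zero_le

/-- Hölder's inequality for three functions. -/
lemma lintegral_rpow_mul_rpow_mul_rpow_le {X : Type*} [MeasurableSpace X] {μ : Measure X}
    {f g h : X → ℝ≥0∞} (hf : AEMeasurable f μ) (hg : AEMeasurable g μ) (hh : AEMeasurable h μ)
    {a b c : ℝ} (ha : 0 ≤ a) (hb : 0 ≤ b) (hc : 0 ≤ c) (habc : a + b + c = 1) :
    ∫⁻ x, f x ^ a * g x ^ b * h x ^ c ∂μ ≤
      (∫⁻ x, f x ∂μ) ^ a * (∫⁻ x, g x ∂μ) ^ b * (∫⁻ x, h x ∂μ) ^ c := by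
  have := ENNReal.lintegral_prod_norm_pow_le (μ := μ) (f := ![f, g, h]) (p := ![a, b, c])
    Finset.univ (by simp [Fin.forall_fin_succ, hf, hg, hh]) (by simpa [Fin.sum_univ_three])
    (by simp [Fin.forall_fin_succ, ha, hb, hc])
  simpa [Fin.prod_univ_three] using this

/-- The Riesz potential maps `L^q` of a disc to `L^(q/(2-q))`. -/
theorem lintegral_rieszPotential_rpow_le {q : ℝ} (hq1 : 1 ≤ q) (hq2 : q < 2) {R : ℝ} (hR : R ≤ 1)
    {g : ℂ → ℝ≥0∞} (hg : Measurable g) :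
    ∫⁻ z in ball (0 : ℂ) R, (∫⁻ y in ball (0 : ℂ) R, g y * ‖y - z‖ₑ⁻¹) ^ (q / (2 - q)) ≤
      (rieszKernelIntegral q * ∫⁻ y in ball (0 : ℂ) R, g y ^ q) ^ (1 / (2 - q)) := by
  have hq0 : 0 < q := by linarith
  have h2q : 0 < 2 - q := by linarith
  set B := ball (0 : ℂ) R with hB
  set A := rieszKernelIntegral q
  set N := ∫⁻ y in B, g y ^ q with hN
  set k : ℂ → ℂ → ℝ≥0∞ := fun z y ↦ ‖y - z‖ₑ⁻¹ with hk
  set r := q / (2 - q) with hr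
  have hr0 : 0 < r := by positivity
  -- Hölder exponents with `1/r + 2e = 1`, for the splitting `gk = (k^q g^q)^(1/r) (k^q)^e (g^q)^e`.
  -- Raised to the power `r`, only the first factor still depends on `z` once the others are
  -- bounded, and Tonelli integrates it. This is Young's inequality with `1 + 1/r = 1/q + 1/q`.
  set e := (q - 1) / q with he
  have he0 : 0 ≤ e := div_nonneg (by linarith) hq0.le
  have hkm : Measurable (Function.uncurry k) := by
    have h1 : Measurable fun p : ℂ × ℂ ↦ ‖p.2 - p.1‖ₑ := (measurable_snd.sub measurable_fst).enorm
    exact h1.inv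
  have hkm' : ∀ z, Measurable (k z) := fun z ↦ (measurable_id.sub_const z).enorm.inv
  have hkm'' : ∀ y, Measurable fun z ↦ k z y := fun y ↦ (measurable_id.const_sub y).enorm.inv
  have pt : ∀ x : ℝ≥0∞, (x ^ q) ^ (1 / r) * (x ^ q) ^ e = x := by
    intro x
    rw [← ENNReal.rpow_mul, ← ENNReal.rpow_mul,
      ← ENNReal.rpow_add_of_nonneg _ _ (by positivity) (by positivity)]
    have : q * (1 / r) + q * e = 1 := by rw [hr, he]; field_simp; ring
    rw [this, ENNReal.rpow_one]
  have holder : ∀ z ∈ B, ∫⁻ y in B, g y * k z y ≤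
      (∫⁻ y in B, k z y ^ q * g y ^ q) ^ (1 / r) * A ^ e * N ^ e := by
    intro z hz
    have h := lintegral_rpow_mul_rpow_mul_rpow_le (μ := volume.restrict B)
      (((hkm' z).pow_const q).mul (hg.pow_const q)).aemeasurable
      ((hkm' z).pow_const q).aemeasurable (hg.pow_const q).aemeasurable
      (a := 1 / r) (b := e) (c := e) (by positivity) he0 he0
      (by rw [hr, he]; field_simp; ring)
    calc ∫⁻ y in B, g y * k z y
        = ∫⁻ y in B, (k z y ^ q * g y ^ q) ^ (1 / r) * (k z y ^ q) ^ e * (g y ^ q) ^ e := by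
          refine lintegral_congr fun y ↦ ?_
          rw [ENNReal.mul_rpow_of_nonneg _ _ (by positivity)]
          calc g y * k z y
              = ((g y ^ q) ^ (1 / r) * (g y ^ q) ^ e) * ((k z y ^ q) ^ (1 / r) * (k z y ^ q) ^ e) := by
                rw [pt, pt]
            _ = _ := by ring
      _ ≤ _ := h
      _ ≤ _ := mul_le_mul' (mul_le_mul' le_rfl (ENNReal.rpow_le_rpow
          (lintegral_inv_enorm_sub_rpow_le q hR hz) he0)) le_rfl
  have hm2 : Measurable (Function.uncurry fun z y ↦ k z y ^ q * g y ^ q) :=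
    (hkm.pow_const q).mul ((hg.comp measurable_snd).pow_const q)
  have hdouble : ∫⁻ z in B, ∫⁻ y in B, k z y ^ q * g y ^ q ≤ A * N := by
    rw [lintegral_lintegral_swap hm2.aemeasurable, hN, ← lintegral_const_mul _ (hg.pow_const q)]
    refine setLIntegral_mono' measurableSet_ball fun y hy ↦ ?_
    rw [lintegral_mul_const _ ((hkm'' y).pow_const q)]
    gcongr
    have hsymm : ∀ z, ‖y - z‖ₑ⁻¹ ^ q = ‖z - y‖ₑ⁻¹ ^ q := fun z ↦ by rw [enorm_sub_rev]
    simp only [hk, hsymm]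
    exact lintegral_inv_enorm_sub_rpow_le q hR hy
  calc ∫⁻ z in B, (∫⁻ y in B, g y * k z y) ^ r
      ≤ ∫⁻ z in B, (∫⁻ y in B, k z y ^ q * g y ^ q) * (A * N) ^ (e * r) := by
        refine setLIntegral_mono' measurableSet_ball fun z hz ↦ ?_
        refine (ENNReal.rpow_le_rpow (holder z hz) hr0.le).trans (le_of_eq ?_)
        rw [mul_assoc, ← ENNReal.mul_rpow_of_nonneg _ _ he0, ENNReal.mul_rpow_of_nonneg _ _ hr0.le,
          ← ENNReal.rpow_mul, ← ENNReal.rpow_mul, one_div, inv_mul_cancel₀ hr0.ne',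
          ENNReal.rpow_one]
    _ = (∫⁻ z in B, ∫⁻ y in B, k z y ^ q * g y ^ q) * (A * N) ^ (e * r) :=
        lintegral_mul_const _ hm2.lintegral_prod_right
    _ ≤ (A * N) ^ (1 : ℝ) * (A * N) ^ (e * r) := by
        rw [ENNReal.rpow_one]; gcongr
    _ = (A * N) ^ (1 / (2 - q)) := by
        rw [← ENNReal.rpow_add_of_nonneg _ _ zero_le_one (by positivity)]
        congr 1
        rw [hr, he]; field_simp; ring

/-- The constant of the two-point Poincaré–Sobolev inequality on discs. -/
noncomputable def twoPointConst (q : ℝ) : ℝ≥0∞ :=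
  ((volume (ball (0 : ℂ) (1 / 2)))⁻¹) ^ (q / (2 - q)) * 2 ^ (q / (2 - q)) *
    2 ^ (q / (2 - q) - 1) * 2 * volume unitDisc * rieszKernelIntegral q ^ (1 / (2 - q))

lemma twoPointConst_lt_top {q : ℝ} (hq1 : 1 ≤ q) (hq2 : q < 2) : twoPointConst q < ⊤ := by
  have h2q : 0 < 2 - q := by linarith
  have hr : 1 ≤ q / (2 - q) := by rw [le_div_iff₀ h2q]; linarith
  have hv : (volume (ball (0 : ℂ) (1 / 2)))⁻¹ < ⊤ :=
    ENNReal.inv_lt_top.mpr (measure_ball_pos _ _ (by norm_num))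
  have hD : volume unitDisc < ⊤ := measure_ball_lt_top
  unfold twoPointConst
  have t2 : (2 : ℝ≥0∞) < ⊤ := by simp
  exact ENNReal.mul_lt_top (ENNReal.mul_lt_top (ENNReal.mul_lt_top (ENNReal.mul_lt_top
    (ENNReal.mul_lt_top (ENNReal.rpow_lt_top_of_nonneg (by linarith) hv.ne)
    (ENNReal.rpow_lt_top_of_nonneg (by linarith) t2.ne))
    (ENNReal.rpow_lt_top_of_nonneg (by linarith) t2.ne)) t2) hD)
    (ENNReal.rpow_lt_top_of_nonneg (by positivity) (rieszKernelIntegral_lt_top hq2).ne)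

/-- Two-point Poincaré–Sobolev inequality on discs, for `C¹` functions. -/
theorem lintegral_lintegral_enorm_sub_rpow_le {q : ℝ} (hq1 : 1 ≤ q) (hq2 : q < 2) {R : ℝ}
    (hR2 : 1 / 2 ≤ R) (hR : R ≤ 1) {u : ℂ → ℝ} (hu : ContDiff ℝ 1 u) :
    ∫⁻ z in ball (0 : ℂ) R, ∫⁻ w in ball (0 : ℂ) R, ‖u z - u w‖ₑ ^ (q / (2 - q)) ≤
      twoPointConst q * (∫⁻ y in ball (0 : ℂ) R, ‖fderiv ℝ u y‖ₑ ^ q) ^ (1 / (2 - q)) := by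
  have h2q : 0 < 2 - q := by linarith
  set r := q / (2 - q) with hr
  have hr1 : 1 ≤ r := by rw [hr, le_div_iff₀ h2q]; linarith
  have hr0 : 0 ≤ r := by linarith
  set B := ball (0 : ℂ) R with hB
  set g : ℂ → ℝ≥0∞ := fun y ↦ ‖fderiv ℝ u y‖ₑ with hg
  have hgm : Measurable g := (hu.continuous_fderiv one_ne_zero).enorm.measurable
  set T : ℂ → ℝ≥0∞ := fun z ↦ ∫⁻ y in B, g y * ‖y - z‖ₑ⁻¹ with hT
  have hTm : Measurable T := by
    refine Measurable.lintegral_prod_right (f := fun z y : ℂ ↦ g y * ‖y - z‖ₑ⁻¹) ?_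
    exact (hgm.comp measurable_snd).mul (by fun_prop : Measurable fun p : ℂ × ℂ ↦ ‖p.2 - p.1‖ₑ).inv
  -- The volume of `B` is bounded below by that of the disc of radius `1/2` and above by that of the
  -- unit disc, so that the constant is uniform in `R`.
  set v := volume (ball (0 : ℂ) (1 / 2)) with hv
  have hvB : v ≤ volume B := measure_mono (ball_subset_ball hR2)
  have hv0 : v ≠ 0 := (measure_ball_pos _ _ (by norm_num)).ne'
  have hvt : v ≠ ⊤ := measure_ball_lt_top.ne
  have hBD : volume B ≤ volume unitDisc := measure_mono (ball_subset_ball hR)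
  -- The triangle inequality through a third point `x`, integrated over `x ∈ B`.
  have pt : ∀ z ∈ B, ∀ w ∈ B, ‖u z - u w‖ₑ ≤ v⁻¹ * (2 * (T z + T w)) := by
    intro z hz w hw
    rw [mul_comm v⁻¹, ← div_eq_mul_inv, ENNReal.le_div_iff_mul_le (.inl hv0) (.inl hvt), mul_comm]
    calc v * ‖u z - u w‖ₑ ≤ volume B * ‖u z - u w‖ₑ := by gcongr
      _ = ∫⁻ x in B, ‖u z - u w‖ₑ := by rw [setLIntegral_const, mul_comm]
      _ ≤ ∫⁻ x in B, (‖u z - u x‖ₑ + ‖u w - u x‖ₑ) := by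
          refine lintegral_mono fun x ↦ ?_
          have : u z - u w = (u z - u x) - (u w - u x) := by ring
          rw [this]
          exact enorm_sub_le
      _ = (∫⁻ x in B, ‖u z - u x‖ₑ) + ∫⁻ x in B, ‖u w - u x‖ₑ :=
          lintegral_add_left (by have := hu.continuous; fun_prop) _
      _ ≤ 2 * T z + 2 * T w := add_le_add (lintegral_enorm_sub_le_rieszPotential hu hR hz)
          (lintegral_enorm_sub_le_rieszPotential hu hR hw)
      _ = _ := by ring
  have young := lintegral_rieszPotential_rpow_le hq1 hq2 hR hgm
  set c := v⁻¹ ^ r * 2 ^ r * 2 ^ (r - 1) with hc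
  calc ∫⁻ z in B, ∫⁻ w in B, ‖u z - u w‖ₑ ^ r
      ≤ ∫⁻ z in B, ∫⁻ w in B, c * (T z ^ r + T w ^ r) := by
        refine setLIntegral_mono' measurableSet_ball fun z hz ↦
          setLIntegral_mono' measurableSet_ball fun w hw ↦ ?_
        refine (ENNReal.rpow_le_rpow (pt z hz w hw) hr0).trans ?_
        rw [ENNReal.mul_rpow_of_nonneg _ _ hr0, ENNReal.mul_rpow_of_nonneg _ _ hr0, hc]
        calc v⁻¹ ^ r * (2 ^ r * (T z + T w) ^ r)
            ≤ v⁻¹ ^ r * (2 ^ r * (2 ^ (r - 1) * (T z ^ r + T w ^ r))) := by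
              gcongr
              exact ENNReal.rpow_add_le_mul_rpow_add_rpow _ _ hr1
          _ = _ := by ring
    _ = c * (2 * volume B * ∫⁻ z in B, T z ^ r) := by
        have hTr := hTm.pow_const r
        have h1 : ∀ z, ∫⁻ w in B, c * (T z ^ r + T w ^ r) =
            c * (T z ^ r * volume B + ∫⁻ w in B, T w ^ r) := by
          intro z
          have hm : Measurable fun w ↦ T z ^ r + T w ^ r := hTr.const_add _
          rw [lintegral_const_mul _ hm, lintegral_add_left measurable_const, setLIntegral_const]
        simp_rw [h1]
        rw [lintegral_const_mul _ ((hTr.mul_const _).add_const _),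
          lintegral_add_left (hTr.mul_const _), lintegral_mul_const _ hTr, setLIntegral_const]
        ring
    _ ≤ c * (2 * volume unitDisc * (rieszKernelIntegral q * ∫⁻ y in B, g y ^ q) ^ (1 / (2 - q))) := by
        gcongr
    _ = _ := by
        rw [ENNReal.mul_rpow_of_nonneg _ _ (by positivity), twoPointConst, hc]
        ring

/-! ### Mollification and the Poincaré–Sobolev inequality on the disc -/

lemma lintegral_enorm_normed (ρ : ContDiffBump (0 : ℂ)) :
    ∫⁻ y, ‖ρ.normed volume y‖ₑ = 1 := by
  have h : ∀ y, ‖ρ.normed volume y‖ₑ = ENNReal.ofReal (ρ.normed volume y) := fun y ↦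
    Real.enorm_of_nonneg (ρ.nonneg_normed y)
  simp_rw [h]
  rw [← ofReal_integral_eq_lintegral_ofReal ρ.integrable_normed
    (Filter.Eventually.of_forall fun y ↦ ρ.nonneg_normed y), ρ.integral_normed, ENNReal.ofReal_one]

/-- The mollification of the restriction of `f` to `closedBall 0 R'`. -/
noncomputable def truncMollify (ρ : ContDiffBump (0 : ℂ)) (R' : ℝ) (f : ℂ → ℝ) : ℂ → ℝ :=
  convolution ((closedBall (0 : ℂ) R').indicator f) (ρ.normed volume)
    (ContinuousLinearMap.lsmul ℝ ℝ) volume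

section Mollify

variable {f : ℂ → ℝ} {G : ℂ → ℂ} {R R' : ℝ} (ρ : ContDiffBump (0 : ℂ))

/-- Local integrability on the disc says nothing up to the boundary; truncation to a smaller closed
disc makes convolution on the plane legitimate. -/
lemma HasWeakGradient.locallyIntegrable_indicator (hf : HasWeakGradient unitDisc f G)
    (hR' : R' < 1) : LocallyIntegrable ((closedBall (0 : ℂ) R').indicator f) := by
  have h1 := (locallyIntegrableOn_iff isOpen_unitDisc.isLocallyClosed).mp hf.locInt _
    (closedBall_subset_ball hR' : closedBall (0 : ℂ) R' ⊆ unitDisc) (isCompact_closedBall _ _)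
  exact ((integrable_indicator_iff measurableSet_closedBall).mpr h1).locallyIntegrable

lemma HasWeakGradient.contDiff_truncMollify (hf : HasWeakGradient unitDisc f G) (hR' : R' < 1) :
    ContDiff ℝ 1 (truncMollify ρ R' f) :=
  ρ.hasCompactSupport_normed.contDiff_convolution_right _ (hf.locallyIntegrable_indicator hR')
    (ρ.contDiff_normed (n := 1))

/-- The gradient of the mollification is bounded by the mollification of the weak gradient. -/
lemma HasWeakGradient.enorm_fderiv_truncMollify_le (hf : HasWeakGradient unitDisc f G)
    (hR' : R' < 1) (hρ : R + ρ.rOut ≤ R') {z : ℂ} (hz : z ∈ ball (0 : ℂ) R) :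
    ‖fderiv ℝ (truncMollify ρ R' f) z‖ₑ ≤
      ∫⁻ y in unitDisc, ‖G y‖ₑ * ‖ρ.normed volume (z - y)‖ₑ := by
  set κ := ρ.normed (volume : Measure ℂ) with hκ
  have hκd : ContDiff ℝ ∞ κ := ρ.contDiff_normed (n := ⊤)
  have hloc := hf.locallyIntegrable_indicator hR'
  have hκc : HasCompactSupport κ := ρ.hasCompactSupport_normed
  have hd := hκc.hasFDerivAt_convolution_right (ContinuousLinearMap.lsmul ℝ ℝ) hloc
    (hκd.of_le (by simp)) z
  have hsub : closedBall z ρ.rOut ⊆ closedBall (0 : ℂ) R' := by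
    refine closedBall_subset_closedBall' ?_
    rw [mem_ball] at hz
    linarith
  have hsubD : closedBall z ρ.rOut ⊆ unitDisc := hsub.trans (closedBall_subset_ball hR')
  -- As a function of `y` the translated kernel is a test function on the disc, supported where the
  -- truncation is invisible. The derivative thus moves from the kernel to `f` as `G`.
  set η : ℂ → ℝ := fun y ↦ κ (z - y) with hη
  have hη0 : ∀ y ∉ closedBall z ρ.rOut, η y = 0 := by
    intro y hy
    refine image_eq_zero_of_notMem_tsupport (f := κ) ?_
    rw [hκ, ρ.tsupport_normed_eq, mem_closedBall_zero_iff]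
    rwa [mem_closedBall', dist_eq_norm] at hy
  have hηd : ContDiff ℝ ∞ η := hκd.comp (contDiff_const.sub contDiff_id)
  have hηc : HasCompactSupport η := HasCompactSupport.intro (isCompact_closedBall _ _) hη0
  have hηs : tsupport η ⊆ closedBall z ρ.rOut := by
    refine closure_minimal (fun y hy ↦ ?_) isClosed_closedBall
    by_contra h
    exact hy (hη0 y h)
  have hηf : ∀ y v, fderiv ℝ η y v = -fderiv ℝ κ (z - y) v := by
    intro y v
    have h1 : HasFDerivAt (fun y ↦ z - y) (-ContinuousLinearMap.id ℝ ℂ) y :=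
      (hasFDerivAt_id y).const_sub z
    have h2 := ((hκd.differentiable (by simp) (z - y)).hasFDerivAt).comp y h1
    have h3 : HasFDerivAt η _ y := h2
    rw [h3.fderiv]
    simp
  rw [truncMollify, hd.fderiv]
  refine ContinuousLinearMap.opENorm_le_bound _ fun v ↦ ?_
  rw [convolution_precompR_apply _ hloc (hκc.fderiv ℝ) (hκd.continuous_fderiv (by simp)),
    convolution_def]
  have hint : ∫ t, (ContinuousLinearMap.lsmul ℝ ℝ ((closedBall (0 : ℂ) R').indicator f t))
      (fderiv ℝ κ (z - t) v) = ∫ y in unitDisc, inner ℝ (G y) v * η y := by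
    rw [← neg_inj, ← hf.byParts η hηd hηc (hηs.trans hsubD) v, ← integral_neg,
      ← integral_indicator measurableSet_unitDisc]
    refine integral_congr_ae (Filter.Eventually.of_forall fun y ↦ ?_)
    simp only [ContinuousLinearMap.lsmul_apply, smul_eq_mul]
    rw [← mul_neg, ← hηf]
    by_cases hy : y ∈ closedBall z ρ.rOut
    · rw [indicator_of_mem (hsub hy), indicator_of_mem (hsubD hy)]
    · have h0 : fderiv ℝ η y = 0 := by
        refine image_eq_zero_of_notMem_tsupport fun h ↦ hy (hηs (tsupport_fderiv_subset ℝ h))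
      simp [h0, indicator]
  rw [hint]
  refine (enorm_integral_le_lintegral_enorm _).trans ?_
  rw [← lintegral_mul_const' _ _ (by simp)]
  refine lintegral_mono fun y ↦ ?_
  rw [enorm_mul, mul_right_comm]
  gcongr
  rw [← ofReal_norm, ← ofReal_norm, ← ofReal_norm, ← ENNReal.ofReal_mul (norm_nonneg _)]
  exact ENNReal.ofReal_le_ofReal (norm_inner_le_norm _ _)

/-- Convolution with a kernel of mass one does not increase the `L^q` norm: Jensen's inequality (as
Hölder) in `y`, then Tonelli. -/
lemma HasWeakGradient.lintegral_fderiv_truncMollify_le (hf : HasWeakGradient unitDisc f G)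
    (hR' : R' < 1) (hρ : R + ρ.rOut ≤ R') {q : ℝ} (hq : 1 ≤ q) :
    ∫⁻ z in ball (0 : ℂ) R, ‖fderiv ℝ (truncMollify ρ R' f) z‖ₑ ^ q ≤
      ∫⁻ y in unitDisc, ‖G y‖ₑ ^ q := by
  have hq0 : 0 < q := by linarith
  set κ := ρ.normed (volume : Measure ℂ) with hκ
  have hκm : Measurable fun y ↦ ‖κ y‖ₑ := (ρ.continuous_normed).enorm.measurable
  have hG : AEMeasurable (fun y ↦ ‖G y‖ₑ) (volume.restrict unitDisc) :=
    hf.locInt_grad.aestronglyMeasurable.enorm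
  have hκz : ∀ z, Measurable fun y ↦ ‖κ (z - y)‖ₑ := fun z ↦
    hκm.comp (measurable_id.const_sub z)
  have hjensen : ∀ z ∈ ball (0 : ℂ) R, ‖fderiv ℝ (truncMollify ρ R' f) z‖ₑ ^ q ≤
      ∫⁻ y in unitDisc, ‖G y‖ₑ ^ q * ‖κ (z - y)‖ₑ := by
    intro z hz
    have he : 0 ≤ 1 - 1 / q := by
      rw [sub_nonneg, div_le_one hq0]; exact hq
    have h1 : ∫⁻ y in unitDisc, ‖G y‖ₑ * ‖κ (z - y)‖ₑ ≤
        (∫⁻ y in unitDisc, ‖G y‖ₑ ^ q * ‖κ (z - y)‖ₑ) ^ (1 / q) := by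
      calc ∫⁻ y in unitDisc, ‖G y‖ₑ * ‖κ (z - y)‖ₑ
          = ∫⁻ y in unitDisc, (‖G y‖ₑ ^ q * ‖κ (z - y)‖ₑ) ^ (1 / q) *
              ‖κ (z - y)‖ₑ ^ (1 - 1 / q) := by
            refine lintegral_congr fun y ↦ ?_
            rw [ENNReal.mul_rpow_of_nonneg _ _ (by positivity), mul_assoc,
              ← ENNReal.rpow_add_of_nonneg _ _ (by positivity) he, ← ENNReal.rpow_mul,
              mul_one_div_cancel hq0.ne', add_sub_cancel, ENNReal.rpow_one, ENNReal.rpow_one]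
        _ ≤ (∫⁻ y in unitDisc, ‖G y‖ₑ ^ q * ‖κ (z - y)‖ₑ) ^ (1 / q) *
              (∫⁻ y in unitDisc, ‖κ (z - y)‖ₑ) ^ (1 - 1 / q) :=
            ENNReal.lintegral_mul_norm_pow_le ((hG.pow_const q).mul (hκz z).aemeasurable)
              (hκz z).aemeasurable (by positivity) he (by ring)
        _ ≤ (∫⁻ y in unitDisc, ‖G y‖ₑ ^ q * ‖κ (z - y)‖ₑ) ^ (1 / q) * 1 := by
            refine mul_le_mul' le_rfl (ENNReal.rpow_le_one ?_ he)
            refine (setLIntegral_le_lintegral _ _).trans (le_of_eq ?_)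
            rw [lintegral_sub_left_eq_self (fun y ↦ ‖κ y‖ₑ) z, lintegral_enorm_normed]
        _ = _ := mul_one _
    calc ‖fderiv ℝ (truncMollify ρ R' f) z‖ₑ ^ q
        ≤ ((∫⁻ y in unitDisc, ‖G y‖ₑ ^ q * ‖κ (z - y)‖ₑ) ^ (1 / q)) ^ q :=
          ENNReal.rpow_le_rpow ((hf.enorm_fderiv_truncMollify_le ρ hR' hρ hz).trans h1) hq0.le
      _ = _ := by
          rw [← ENNReal.rpow_mul, one_div_mul_cancel hq0.ne', ENNReal.rpow_one]
  have hm : AEMeasurable (Function.uncurry fun z y ↦ ‖G y‖ₑ ^ q * ‖κ (z - y)‖ₑ)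
      ((volume.restrict (ball (0 : ℂ) R)).prod (volume.restrict unitDisc)) := by
    refine AEMeasurable.mul ?_ ?_
    · exact (hG.pow_const q).comp_quasiMeasurePreserving Measure.quasiMeasurePreserving_snd
    · exact (hκm.comp (measurable_fst.sub measurable_snd)).aemeasurable
  calc ∫⁻ z in ball (0 : ℂ) R, ‖fderiv ℝ (truncMollify ρ R' f) z‖ₑ ^ q
      ≤ ∫⁻ z in ball (0 : ℂ) R, ∫⁻ y in unitDisc, ‖G y‖ₑ ^ q * ‖κ (z - y)‖ₑ :=
        setLIntegral_mono' measurableSet_ball hjensen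
    _ = ∫⁻ y in unitDisc, ∫⁻ z in ball (0 : ℂ) R, ‖G y‖ₑ ^ q * ‖κ (z - y)‖ₑ :=
        lintegral_lintegral_swap hm
    _ ≤ ∫⁻ y in unitDisc, ‖G y‖ₑ ^ q := by
        refine lintegral_mono fun y ↦ ?_
        have hκy : Measurable fun z ↦ ‖κ (z - y)‖ₑ := hκm.comp (measurable_id.sub_const y)
        rw [lintegral_const_mul _ hκy]
        refine mul_le_of_le_one_right' ?_
        refine (setLIntegral_le_lintegral _ _).trans (le_of_eq ?_)
        rw [lintegral_sub_right_eq_self (fun y ↦ ‖κ y‖ₑ) y, lintegral_enorm_normed]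

end Mollify

/-- Two-point Poincaré–Sobolev inequality for weakly differentiable functions, on a smaller
disc. -/
theorem HasWeakGradient.lintegral_lintegral_ball_le {f : ℂ → ℝ} {G : ℂ → ℂ}
    (hf : HasWeakGradient unitDisc f G) {q : ℝ} (hq1 : 1 ≤ q) (hq2 : q < 2) {R : ℝ}
    (hR2 : 1 / 2 ≤ R) (hR : R < 1) :
    ∫⁻ z in ball (0 : ℂ) R, ∫⁻ w in ball (0 : ℂ) R, ‖f z - f w‖ₑ ^ (q / (2 - q)) ≤
      twoPointConst q * (∫⁻ y in unitDisc, ‖G y‖ₑ ^ q) ^ (1 / (2 - q)) := by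
  have h2q : 0 < 2 - q := by linarith
  set r := q / (2 - q) with hr
  have hr0 : 0 < r := by positivity
  set B := ball (0 : ℂ) R with hB
  set M := twoPointConst q * (∫⁻ y in unitDisc, ‖G y‖ₑ ^ q) ^ (1 / (2 - q)) with hM
  set R' := (1 + R) / 2 with hR'
  have hR'1 : R' < 1 := by rw [hR']; linarith
  have hδ : 0 < R' - R := by rw [hR']; linarith
  -- The outer radii tend to `0` and never exceed `R' - R`; the outer radius is twice the inner one,
  -- and this bounded ratio gives convergence almost everywhere for locally integrable functions.
  set ρ : ℕ → ContDiffBump (0 : ℂ) := fun n ↦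
    ⟨(R' - R) * (1 / ((n : ℝ) + 1)) / 2, (R' - R) * (1 / ((n : ℝ) + 1)), by positivity,
      half_lt_self (by positivity)⟩ with hρ
  have hρR : ∀ n, R + (ρ n).rOut ≤ R' := by
    intro n
    have h1 : 1 / ((n : ℝ) + 1) ≤ 1 := by
      rw [div_le_one (by positivity)]; linarith [(Nat.cast_nonneg n : (0 : ℝ) ≤ n)]
    have h2 : (R' - R) * (1 / ((n : ℝ) + 1)) ≤ R' - R := mul_le_of_le_one_right hδ.le h1
    change R + (R' - R) * (1 / ((n : ℝ) + 1)) ≤ R'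
    linarith
  set u : ℕ → ℂ → ℝ := fun n ↦ truncMollify (ρ n) R' f with hu
  have hud : ∀ n, ContDiff ℝ 1 (u n) := fun n ↦ hf.contDiff_truncMollify (ρ n) hR'1
  have hlim : ∀ᵐ z ∂(volume.restrict B), Filter.Tendsto (fun n ↦ u n z) Filter.atTop
      (nhds (f z)) := by
    have h0 : Filter.Tendsto (fun n ↦ (ρ n).rOut) Filter.atTop (nhds 0) := by
      have := (tendsto_one_div_add_atTop_nhds_zero_nat (𝕜 := ℝ)).const_mul (R' - R)
      rwa [mul_zero] at this
    have h1 := ContDiffBump.ae_convolution_tendsto_right_of_locallyIntegrable (μ := volume) (K := 2)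
      h0 (Filter.Eventually.of_forall fun n ↦ by
        change (R' - R) * (1 / ((n : ℝ) + 1)) ≤ 2 * ((R' - R) * (1 / ((n : ℝ) + 1)) / 2)
        linarith) (hf.locallyIntegrable_indicator hR'1)
    filter_upwards [ae_restrict_of_ae h1, self_mem_ae_restrict measurableSet_ball] with z hz hzB
    have hzB' : z ∈ closedBall (0 : ℂ) R' :=
      ball_subset_closedBall (ball_subset_ball (by linarith) hzB)
    rw [indicator_of_mem hzB'] at hz
    refine hz.congr fun n ↦ ?_
    rw [hu]
    simp only [truncMollify]
    rw [convolution_lsmul_swap, convolution_def]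
    simp only [ContinuousLinearMap.lsmul_apply, smul_eq_mul, mul_comm]
  set F : ℕ → ℂ → ℂ → ℝ≥0∞ := fun n z w ↦ ‖u n z - u n w‖ₑ ^ r with hF
  have hFm : ∀ n, Measurable (Function.uncurry (F n)) := by
    intro n
    have hc := (hud n).continuous
    exact (by fun_prop : Continuous fun p : ℂ × ℂ ↦ u n p.1 - u n p.2).enorm.measurable.pow_const r
  have hFz : ∀ n z, Measurable (F n z) := by
    intro n z
    have hc := (hud n).continuous
    exact (by fun_prop : Continuous fun w ↦ u n z - u n w).enorm.measurable.pow_const r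
  have hFb : ∀ n, ∫⁻ z in B, ∫⁻ w in B, F n z w ≤ M := by
    intro n
    refine (lintegral_lintegral_enorm_sub_rpow_le hq1 hq2 hR2 hR.le (hud n)).trans ?_
    refine mul_le_mul' le_rfl (ENNReal.rpow_le_rpow ?_ (by positivity))
    exact hf.lintegral_fderiv_truncMollify_le (ρ n) hR'1 (hρR n) hq1
  -- Fatou's lemma in each variable. The two-point form has no additive constants whose convergence
  -- would have to be controlled.
  calc ∫⁻ z in B, ∫⁻ w in B, ‖f z - f w‖ₑ ^ r
      = ∫⁻ z in B, ∫⁻ w in B, Filter.liminf (fun n ↦ F n z w) Filter.atTop := by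
        refine lintegral_congr_ae ?_
        filter_upwards [hlim] with z hz
        refine lintegral_congr_ae ?_
        filter_upwards [hlim] with w hw
        have h1 : Filter.Tendsto (fun n ↦ F n z w) Filter.atTop (nhds (‖f z - f w‖ₑ ^ r)) :=
          ((hz.sub hw).enorm).ennrpow_const r
        exact h1.liminf_eq.symm
    _ ≤ ∫⁻ z in B, Filter.liminf (fun n ↦ ∫⁻ w in B, F n z w) Filter.atTop :=
        lintegral_mono fun z ↦ lintegral_liminf_le fun n ↦ hFz n z
    _ ≤ Filter.liminf (fun n ↦ ∫⁻ z in B, ∫⁻ w in B, F n z w) Filter.atTop :=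
        lintegral_liminf_le fun n ↦ (hFm n).lintegral_prod_right
    _ ≤ M := Filter.liminf_le_of_frequently_le' (Filter.Frequently.of_forall hFb)

lemma iUnion_ball_eq_unitDisc :
    ⋃ n : ℕ, ball (0 : ℂ) (1 - 1 / ((n : ℝ) + 2)) = unitDisc := by
  refine subset_antisymm (iUnion_subset fun n ↦ ball_subset_ball ?_) fun z hz ↦ ?_
  · have : 0 < 1 / ((n : ℝ) + 2) := by positivity
    linarith
  · rw [mem_unitDisc] at hz
    obtain ⟨n, hn⟩ := exists_nat_one_div_lt (sub_pos.mpr hz)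
    refine mem_iUnion.mpr ⟨n, ?_⟩
    rw [mem_ball_zero_iff]
    have : 1 / ((n : ℝ) + 2) ≤ 1 / ((n : ℝ) + 1) := by gcongr; norm_num
    linarith

/-- Monotone convergence over the discs of radius `1 - 1/(n+2)`; the shift by `2` keeps all radii at
least `1/2`, where the constant is uniform. The measurable version `g` of `f` allows the iterated
integral to be read on the product. -/
theorem HasWeakGradient.lintegral_lintegral_unitDisc_le {f g : ℂ → ℝ} {G : ℂ → ℂ}
    (hf : HasWeakGradient unitDisc f G) (hg : Measurable g) (hfg : f =ᵐ[volume.restrict unitDisc] g)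
    {q : ℝ} (hq1 : 1 ≤ q) (hq2 : q < 2) :
    ∫⁻ z in unitDisc, ∫⁻ w in unitDisc, ‖g z - g w‖ₑ ^ (q / (2 - q)) ≤
      twoPointConst q * (∫⁻ y in unitDisc, ‖G y‖ₑ ^ q) ^ (1 / (2 - q)) := by
  set r := q / (2 - q) with hr
  set F : ℂ × ℂ → ℝ≥0∞ := fun p ↦ ‖g p.1 - g p.2‖ₑ ^ r with hF
  have hFm : Measurable F :=
    ((hg.comp measurable_fst).sub (hg.comp measurable_snd)).enorm.pow_const r
  have hprod : ∀ S : Set ℂ, ∫⁻ z in S, ∫⁻ w in S, ‖g z - g w‖ₑ ^ r =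
      ∫⁻ p in S ×ˢ S, F p ∂(volume.prod volume) := by
    intro S
    rw [← Measure.prod_restrict, lintegral_prod _ hFm.aemeasurable]
  set b : ℕ → ℝ := fun n ↦ 1 - 1 / ((n : ℝ) + 2) with hb
  have hbm : Monotone b := by
    intro m n hmn
    have : (m : ℝ) ≤ n := Nat.cast_le.mpr hmn
    simp only [hb]
    gcongr
  have hS : Monotone fun n ↦ ball (0 : ℂ) (b n) ×ˢ ball (0 : ℂ) (b n) := fun m n hmn ↦
    prod_mono (ball_subset_ball (hbm hmn)) (ball_subset_ball (hbm hmn))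
  have hU : unitDisc ×ˢ unitDisc = ⋃ n, ball (0 : ℂ) (b n) ×ˢ ball (0 : ℂ) (b n) := by
    rw [← iUnion_ball_eq_unitDisc]
    refine (iUnion_prod_of_monotone ?_ ?_).symm <;>
      exact fun m n hmn ↦ ball_subset_ball (hbm hmn)
  rw [hprod, hU, setLIntegral_iUnion_of_directed _ hS.directed_le]
  refine iSup_le fun n ↦ ?_
  rw [← hprod]
  have hb2 : 1 / 2 ≤ b n := by
    have : 1 / ((n : ℝ) + 2) ≤ 1 / 2 := by
      gcongr; linarith [(Nat.cast_nonneg n : (0 : ℝ) ≤ n)]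
    simp only [hb]
    linarith
  have hb1 : b n < 1 := by
    have : 0 < 1 / ((n : ℝ) + 2) := by positivity
    simp only [hb]
    linarith
  refine le_trans (le_of_eq ?_) (hf.lintegral_lintegral_ball_le hq1 hq2 hb2 hb1)
  have hfg' : f =ᵐ[volume.restrict (ball (0 : ℂ) (b n))] g :=
    ae_restrict_of_ae_restrict_of_subset (ball_subset_ball hb1.le) hfg
  refine lintegral_congr_ae ?_
  filter_upwards [hfg'] with z hz
  refine lintegral_congr_ae ?_
  filter_upwards [hfg'] with w hw
  rw [hz, hw]

/-- The Poincaré–Sobolev inequality on the disc: functions with weak gradient in `L^q` belong,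
up to a constant, to `L^(q/(2-q))`. -/
theorem exists_eLpNorm_sub_le_of_hasWeakGradient {q : ℝ} (hq1 : 1 ≤ q) (hq2 : q < 2) :
    ∃ C : ℝ≥0, ∀ (f : ℂ → ℝ) (G : ℂ → ℂ), HasWeakGradient unitDisc f G →
      ∃ c : ℝ, eLpNorm (fun z ↦ f z - c) (ENNReal.ofReal (q / (2 - q))) (volume.restrict unitDisc) ≤
        C * eLpNorm G (ENNReal.ofReal q) (volume.restrict unitDisc) := by
  have h2q : 0 < 2 - q := by linarith
  have hq0 : 0 < q := by linarith
  set r := q / (2 - q) with hr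
  have hr0 : 0 < r := by positivity
  have hv0 : volume unitDisc ≠ 0 := (measure_ball_pos _ _ one_pos).ne'
  have hvt : volume unitDisc ≠ ⊤ := measure_ball_lt_top.ne
  set K := ((volume unitDisc)⁻¹ * twoPointConst q) ^ (1 / r) with hK
  have hKt : K ≠ ⊤ := (ENNReal.rpow_lt_top_of_nonneg (by positivity)
    (ENNReal.mul_lt_top (ENNReal.inv_lt_top.mpr (pos_iff_ne_zero.mpr hv0))
      (twoPointConst_lt_top hq1 hq2)).ne).ne
  refine ⟨K.toNNReal, fun f G hf ↦ ?_⟩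
  obtain ⟨g, hg, hfg⟩ := hf.locInt.aestronglyMeasurable.aemeasurable
  have h := hf.lintegral_lintegral_unitDisc_le hg hfg hq1 hq2
  rw [← hr] at h
  have hm : Measurable fun z ↦ ∫⁻ w in unitDisc, ‖g z - g w‖ₑ ^ r :=
    Measurable.lintegral_prod_right (f := fun z w ↦ ‖g z - g w‖ₑ ^ r)
      (((hg.comp measurable_fst).sub (hg.comp measurable_snd)).enorm.pow_const r)
  -- At some `w` the inner integral is at most its average, and `c = g w` is taken. The mean of `f`
  -- is not available, as integrability on the whole disc is not yet known.
  obtain ⟨w, -, hw⟩ := exists_le_setLAverage hv0 hvt hm.aemeasurable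
  refine ⟨g w, ?_⟩
  rw [ENNReal.coe_toNNReal hKt, eLpNorm_eq_lintegral_rpow_enorm_toReal (by simpa) (by simp),
    eLpNorm_eq_lintegral_rpow_enorm_toReal (by simpa) (by simp), ENNReal.toReal_ofReal hr0.le,
    ENNReal.toReal_ofReal hq0.le]
  rw [setLAverage_eq] at hw
  have e : ∫⁻ z in unitDisc, ‖f z - g w‖ₑ ^ r = ∫⁻ z in unitDisc, ‖g w - g z‖ₑ ^ r := by
    refine lintegral_congr_ae ?_
    filter_upwards [hfg] with z hz
    rw [hz, enorm_sub_rev]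
  calc (∫⁻ z in unitDisc, ‖f z - g w‖ₑ ^ r) ^ (1 / r)
      ≤ ((volume unitDisc)⁻¹ * twoPointConst q *
          (∫⁻ y in unitDisc, ‖G y‖ₑ ^ q) ^ (1 / (2 - q))) ^ (1 / r) := by
        refine ENNReal.rpow_le_rpow ?_ (by positivity)
        rw [e, mul_assoc, mul_comm, ← div_eq_mul_inv]
        exact hw.trans (ENNReal.div_le_div_right h _)
    _ = K * (∫⁻ y in unitDisc, ‖G y‖ₑ ^ q) ^ (1 / q) := by
        rw [ENNReal.mul_rpow_of_nonneg _ _ (by positivity), ← ENNReal.rpow_mul]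
        congr 2
        rw [hr]
        field_simp

lemma eLpNorm_ofReal_eq {X E : Type*} [MeasurableSpace X] [ENorm E] {μ : Measure X} (f : X → E)
    {r : ℝ} (hr : 0 < r) :
    eLpNorm f (ENNReal.ofReal r) μ = (∫⁻ x, ‖f x‖ₑ ^ r ∂μ) ^ (1 / r) := by
  rw [eLpNorm_eq_lintegral_rpow_enorm_toReal (by simpa) (by simp), ENNReal.toReal_ofReal hr.le]

instance : IsFiniteMeasure (volume.restrict unitDisc) :=
  ⟨by rw [Measure.restrict_apply_univ]; exact measure_ball_lt_top⟩

/-! ### Best constants -/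

/-- If `A = 0` and no `K` is admissible, the right side is `0 · ∞ = 0` and the hypothesis is
vacuous; `h0` excludes this case. -/
lemma le_mul_iInf_coe {P : ℝ≥0 → Prop} {x A : ℝ≥0∞} (hA : A ≠ ⊤) (h0 : A ≠ 0 ∨ ∃ K, P K)
    (h : ∀ K, P K → x ≤ A * K) : x ≤ A * ⨅ (K : ℝ≥0) (_ : P K), (K : ℝ≥0∞) := by
  rcases eq_or_ne A 0 with rfl | hA0
  · obtain ⟨K, hK⟩ := h0.resolve_left (by simp)
    simpa using h K hK
  · rw [← ENNReal.div_le_iff' hA0 hA]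
    exact le_iInf₂ fun K hK ↦ (ENNReal.div_le_iff' hA0 hA).mpr (h K hK)

lemma exists_of_iInf_coe_lt_top {P : ℝ≥0 → Prop}
    (h : ⨅ (K : ℝ≥0) (_ : P K), (K : ℝ≥0∞) < ⊤) : ∃ K, P K := by
  simp only [iInf_lt_iff] at h
  exact ⟨h.choose, h.choose_spec.choose⟩

lemma PoincareSobolev.poincareConst_le {Ω : Set ℂ} {μ : Measure ℂ} {r p : ℝ} {B : ℝ≥0}
    (h : PoincareSobolev Ω μ r p B) : poincareConst Ω μ r p ≤ B := iInf₂_le B h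

/-- A finite best constant is attained. -/
lemma iInf_eLpNorm_le_poincareConst_mul {Ω : Set ℂ} {μ : Measure ℂ} {r p : ℝ}
    (h : poincareConst Ω μ r p < ⊤) {f : ℂ → ℝ} {G : ℂ → ℂ} (hf : MemW1p Ω p f G) :
    (⨅ c : ℝ, eLpNorm (fun z ↦ f z - c) (ENNReal.ofReal r) μ) ≤
      poincareConst Ω μ r p * eLpNorm G (ENNReal.ofReal p) (volume.restrict Ω) := by
  rw [mul_comm]
  refine le_mul_iInf_coe hf.memLp_grad.2.ne (.inr (exists_of_iInf_coe_lt_top h)) fun B hB ↦ ?_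
  rw [mul_comm]
  exact hB f G hf

lemma le_div_two_sub {q : ℝ} (hq1 : 1 ≤ q) (hq2 : q < 2) : q ≤ q / (2 - q) := by
  rw [le_div_iff₀ (by linarith)]
  nlinarith

/-- On the disc, `L^{1,q}` is contained in `W^{1,q}`. -/
theorem MemL1p.memW1p {q : ℝ} (hq1 : 1 ≤ q) (hq2 : q < 2) {f : ℂ → ℝ} {G : ℂ → ℂ}
    (hf : MemL1p unitDisc q f G) : MemW1p unitDisc q f G := by
  refine ⟨hf.weakGrad, ?_, hf.memLp_grad⟩
  obtain ⟨C, hC⟩ := exists_eLpNorm_sub_le_of_hasWeakGradient hq1 hq2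
  obtain ⟨c, hc⟩ := hC f G hf.weakGrad
  have hm : AEStronglyMeasurable f (volume.restrict unitDisc) :=
    hf.weakGrad.locInt.aestronglyMeasurable
  have h1 : MemLp (fun z ↦ f z - c) (ENNReal.ofReal (q / (2 - q))) (volume.restrict unitDisc) :=
    ⟨hm.sub aestronglyMeasurable_const,
      hc.trans_lt (ENNReal.mul_lt_top ENNReal.coe_lt_top hf.memLp_grad.2)⟩
  have h2 := (h1.mono_exponent (ENNReal.ofReal_le_ofReal (le_div_two_sub hq1 hq2))).add
    (memLp_const c)
  refine h2.ae_eq (Filter.Eventually.of_forall fun z ↦ ?_)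
  simp

theorem constB_unitDisc_lt_top {q r : ℝ} (hq1 : 1 ≤ q) (hq2 : q < 2)
    (hrq : r ≤ q / (2 - q)) (hr : 1 ≤ r) : constB r q unitDisc < ⊤ := by
  obtain ⟨C, hC⟩ := exists_eLpNorm_sub_le_of_hasWeakGradient hq1 hq2
  set V : ℝ≥0∞ := (volume.restrict unitDisc) univ ^
    (1 / (ENNReal.ofReal r).toReal - 1 / (ENNReal.ofReal (q / (2 - q))).toReal) with hV
  have hVt : V ≠ ⊤ := by
    refine ENNReal.rpow_ne_top_of_nonneg ?_ (measure_ne_top _ _)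
    rw [ENNReal.toReal_ofReal (by linarith), ENNReal.toReal_ofReal (by linarith), sub_nonneg]
    exact one_div_le_one_div_of_le (by linarith) hrq
  have h : PoincareSobolev unitDisc (volume.restrict unitDisc) r q (C * V.toNNReal) := by
    intro f G hf
    obtain ⟨c, hc⟩ := hC f G hf.weakGrad
    have hm : AEStronglyMeasurable f (volume.restrict unitDisc) := hf.memLp.1
    refine (iInf_le _ c).trans ((eLpNorm_le_eLpNorm_mul_rpow_measure_univ
      (ENNReal.ofReal_le_ofReal hrq) (hm.sub aestronglyMeasurable_const)).trans ?_)
    rw [ENNReal.coe_mul, ENNReal.coe_toNNReal hVt, mul_right_comm]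
    exact mul_le_mul' hc le_rfl
  exact h.poincareConst_le.trans_lt ENNReal.coe_lt_top

/-! ### Smooth functions -/

lemma hasWeakGradient_of_contDiff (U : Set ℂ) {f : ℂ → ℝ} (hf : ContDiff ℝ ∞ f) :
    HasWeakGradient U f (gradient f) := by
  have hgc : Continuous (gradient f) :=
    (InnerProductSpace.toDual ℝ ℂ).symm.continuous.comp (hf.continuous_fderiv (by simp))
  refine ⟨(hf.continuous.locallyIntegrable).locallyIntegrableOn _,
    hgc.locallyIntegrable.locallyIntegrableOn _, fun η hη hc hs v ↦ ?_⟩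
  have hin : ∀ z, inner ℝ (gradient f z) v = fderiv ℝ f z v := fun z ↦
    InnerProductSpace.toDual_symm_apply
  simp_rw [hin]
  have hfd : Continuous fun z ↦ fderiv ℝ f z v :=
    (hf.continuous_fderiv (by simp)).clm_apply continuous_const
  have hηd : Continuous fun z ↦ fderiv ℝ η z v :=
    (hη.continuous_fderiv (by simp)).clm_apply continuous_const
  have hsupp : ∀ z ∉ U, η z = 0 := fun z hz ↦
    image_eq_zero_of_notMem_tsupport fun h ↦ hz (hs h)
  have hsupp' : ∀ z ∉ U, fderiv ℝ η z v = 0 := fun z hz ↦ by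
    rw [image_eq_zero_of_notMem_tsupport fun h ↦ hz (hs (tsupport_fderiv_subset ℝ h))]
    rfl
  rw [setIntegral_eq_integral_of_forall_compl_eq_zero fun z hz ↦ by rw [hsupp' z hz, mul_zero],
    setIntegral_eq_integral_of_forall_compl_eq_zero fun z hz ↦ by rw [hsupp z hz, mul_zero]]
  exact integral_mul_fderiv_eq_neg_fderiv_mul_of_integrable
    ((hfd.mul hη.continuous).integrable_of_hasCompactSupport hc.mul_left)
    ((hf.continuous.mul hηd).integrable_of_hasCompactSupport (hc.fderiv_apply ℝ v).mul_left)
    ((hf.continuous.mul hη.continuous).integrable_of_hasCompactSupport hc.mul_left)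
    (fun z _ ↦ hf.differentiable (by simp) z) (fun z _ ↦ hη.differentiable (by simp) z)

lemma memL1p_of_contDiff_hasCompactSupport (U : Set ℂ) {f : ℂ → ℝ}
    (hf : ContDiff ℝ ∞ f) (hc : HasCompactSupport f) (p : ℝ) : MemL1p U p f (gradient f) := by
  have hgc : Continuous (gradient f) :=
    (InnerProductSpace.toDual ℝ ℂ).symm.continuous.comp (hf.continuous_fderiv (by simp))
  have hgs : HasCompactSupport (gradient f) :=
    (hc.fderiv ℝ).comp_left (g := (InnerProductSpace.toDual ℝ ℂ).symm) (map_zero _)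
  exact ⟨hasWeakGradient_of_contDiff U hf, hgc.memLp_of_hasCompactSupport hgs⟩

/-- The real part is odd under `z ↦ -z`, so `re - c` and `re + c` have equal norms, and `2 re` is
their sum. -/
lemma eLpNorm_re_le_eLpNorm_re_sub {r : ℝ} (hr : 1 ≤ r) (c : ℝ) :
    eLpNorm (fun z : ℂ ↦ z.re) (ENNReal.ofReal r) (volume.restrict unitDisc) ≤
      eLpNorm (fun z : ℂ ↦ z.re - c) (ENNReal.ofReal r) (volume.restrict unitDisc) := by
  set μ := (volume : Measure ℂ).restrict unitDisc with hμ
  have hcont : ∀ c : ℝ, Continuous fun z : ℂ ↦ z.re - c := fun c ↦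
    Complex.continuous_re.sub continuous_const
  have hpre : (Neg.neg : ℂ → ℂ) ⁻¹' unitDisc = unitDisc := by
    ext z; simp [unitDisc]
  have hneg : MeasurePreserving (Neg.neg : ℂ → ℂ) μ μ := by
    have := (Measure.measurePreserving_neg (volume : Measure ℂ)).restrict_preimage
      measurableSet_unitDisc
    rwa [hpre] at this
  have h1 : eLpNorm (fun z : ℂ ↦ z.re - -c) (ENNReal.ofReal r) μ =
      eLpNorm (fun z : ℂ ↦ z.re - c) (ENNReal.ofReal r) μ := by
    rw [← eLpNorm_comp_measurePreserving (hcont c).aestronglyMeasurable hneg, ← eLpNorm_neg]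
    congr 1
    ext z
    simp
    ring
  have h2 : eLpNorm ((fun z : ℂ ↦ z.re - c) + fun z : ℂ ↦ z.re - -c) (ENNReal.ofReal r) μ ≤
      2 * eLpNorm (fun z : ℂ ↦ z.re - c) (ENNReal.ofReal r) μ := by
    refine (eLpNorm_add_le (hcont c).aestronglyMeasurable (hcont (-c)).aestronglyMeasurable
      (by simpa using hr)).trans ?_
    rw [h1, two_mul]
  have h3 : ((fun z : ℂ ↦ z.re - c) + fun z : ℂ ↦ z.re - -c) = (2 : ℝ) • fun z : ℂ ↦ z.re := by
    ext z
    simp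
    ring
  rw [h3, eLpNorm_const_smul] at h2
  have e2 : ‖(2 : ℝ)‖ₑ = 2 := by
    rw [Real.enorm_of_nonneg zero_le_two, ENNReal.ofReal_ofNat]
  rw [e2] at h2
  exact (ENNReal.mul_le_mul_iff_right (by simp) (by simp)).mp h2

/-- The real part is a nonconstant function in `W^{1,q}`, and its best approximating constant is
`0`. -/
theorem constB_unitDisc_ne_zero {q r : ℝ} (hr : 1 ≤ r) :
    constB r q unitDisc ≠ 0 := by
  intro h0
  have hre : ContDiff ℝ ∞ fun z : ℂ ↦ z.re := Complex.reCLM.contDiff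
  have hgrad : ∀ z, gradient (fun z : ℂ ↦ z.re) z = (InnerProductSpace.toDual ℝ ℂ).symm
      Complex.reCLM := fun z ↦ by
    have : fderiv ℝ (fun z : ℂ ↦ z.re) z = Complex.reCLM := Complex.reCLM.fderiv
    rw [gradient, this]
  have hW : MemW1p unitDisc q (fun z : ℂ ↦ z.re) (gradient fun z : ℂ ↦ z.re) := by
    refine ⟨hasWeakGradient_of_contDiff unitDisc hre, ?_, ?_⟩
    · refine MemLp.of_bound hre.continuous.aestronglyMeasurable 1 ?_
      filter_upwards [self_mem_ae_restrict measurableSet_unitDisc] with z hz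
      exact (Complex.abs_re_le_norm z).trans (mem_unitDisc.mp hz).le
    · rw [funext hgrad]
      exact memLp_const _
  have hle := iInf_eLpNorm_le_poincareConst_mul (by
    change constB r q unitDisc < ⊤
    rw [h0]; simp) hW
  change _ ≤ constB r q unitDisc * _ at hle
  rw [h0, zero_mul] at hle
  have hz : eLpNorm (fun z : ℂ ↦ z.re) (ENNReal.ofReal r) (volume.restrict unitDisc) = 0 :=
    le_antisymm ((le_iInf fun c ↦ eLpNorm_re_le_eLpNorm_re_sub hr c).trans hle) zero_le
  rw [eLpNorm_eq_zero_iff hre.continuous.aestronglyMeasurable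
    (by simpa using by linarith)] at hz
  have heq := Measure.eqOn_open_of_ae_eq hz isOpen_unitDisc hre.continuous.continuousOn
    continuousOn_const
  have := heq (show (1 / 2 : ℂ) ∈ unitDisc by rw [mem_unitDisc]; norm_num)
  norm_num at this

/-- If the composition operator has norm zero, all functions in `L^{1,q}(𝔻)` coming from
`L^{1,p}(Ω)` are orthogonal to the derivatives of test functions. -/
lemma integral_mul_fderiv_eq_zero_of_constK_eq_zero {p q : ℝ} (hq : 1 ≤ q) {Ω : Set ℂ} {ψ : ℂ → ℂ}
    (hK : constK p q Ω ψ = 0) {f : ℂ → ℝ} {G : ℂ → ℂ} (hf : MemL1p Ω p f G) {η : ℂ → ℝ}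
    (hη : ContDiff ℝ ∞ η) (hc : HasCompactSupport η) (hs : tsupport η ⊆ unitDisc) (v : ℂ) :
    ∫ w in unitDisc, f (ψ w) * fderiv ℝ η w v = 0 := by
  obtain ⟨S, hS⟩ := hc.exists_bound_of_continuous hη.continuous
  set V : ℝ≥0∞ := (volume.restrict unitDisc) univ ^
    (1 / (1 : ℝ≥0∞).toReal - 1 / (ENNReal.ofReal q).toReal) with hV
  have hVt : V ≠ ⊤ := by
    refine ENNReal.rpow_ne_top_of_nonneg ?_ (measure_ne_top _ _)
    rw [ENNReal.toReal_ofReal (by linarith), ENNReal.toReal_one, sub_nonneg]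
    exact one_div_le_one_div_of_le one_pos hq
  set N := eLpNorm G (ENNReal.ofReal p) (volume.restrict Ω) with hN
  set A := ‖v‖ₑ * ENNReal.ofReal S * V * N with hA
  have hAt : A ≠ ⊤ := by
    refine ENNReal.mul_ne_top (ENNReal.mul_ne_top (ENNReal.mul_ne_top ?_ ?_) hVt) hf.memLp_grad.2.ne
      <;> simp
  rw [← enorm_eq_zero, ← nonpos_iff_eq_zero]
  -- The gradient `H` may change with `K`, but the integral on the left does not, so the bound
  -- passes to the infimum.
  have key : ‖∫ w in unitDisc, f (ψ w) * fderiv ℝ η w v‖ₑ ≤ A * constK p q Ω ψ := by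
    refine le_mul_iInf_coe hAt (.inr (exists_of_iInf_coe_lt_top
      (show constK p q Ω ψ < ⊤ by rw [hK]; simp))) fun K hKf ↦ ?_
    obtain ⟨H, hH, hle⟩ := hKf f G hf
    have hby := hH.weakGrad.byParts η hη hc hs v
    simp only [Function.comp_apply] at hby
    rw [hby, enorm_neg]
    calc ‖∫ w in unitDisc, inner ℝ (H w) v * η w‖ₑ
        ≤ ∫⁻ w in unitDisc, ‖v‖ₑ * ENNReal.ofReal S * ‖H w‖ₑ := by
          refine (enorm_integral_le_lintegral_enorm _).trans (lintegral_mono fun w ↦ ?_)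
          rw [enorm_mul]
          calc ‖inner ℝ (H w) v‖ₑ * ‖η w‖ₑ ≤ (‖H w‖ₑ * ‖v‖ₑ) * ENNReal.ofReal S := by
                gcongr
                · rw [← ofReal_norm, ← ofReal_norm, ← ofReal_norm,
                    ← ENNReal.ofReal_mul (norm_nonneg _)]
                  exact ENNReal.ofReal_le_ofReal (norm_inner_le_norm _ _)
                · rw [← ofReal_norm]
                  exact ENNReal.ofReal_le_ofReal (hS w)
            _ = _ := by ring
      _ = ‖v‖ₑ * ENNReal.ofReal S * eLpNorm H 1 (volume.restrict unitDisc) := by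
          rw [lintegral_const_mul' _ _ (by finiteness), eLpNorm_one_eq_lintegral_enorm]
      _ ≤ ‖v‖ₑ * ENNReal.ofReal S * ((K * N) * V) := by
          refine mul_le_mul' le_rfl ((eLpNorm_le_eLpNorm_mul_rpow_measure_univ
            (by simpa using hq) hH.memLp_grad.1).trans (mul_le_mul' hle le_rfl))
      _ = A * K := by rw [hA]; ring
  rwa [hK, mul_zero] at key

/-- The bump `b₁` on the disc is `f ∘ ψ` for a smooth compactly supported `f` on `Ω`. Testing with
`η = x b₂`, where `b₂ = 1` on the support of `b₁`, gives `∫ b₁ ∂ₓη = ∫ b₁ > 0`. -/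
theorem constK_ne_zero {p q : ℝ} (hq : 1 ≤ q) {Ω : Set ℂ} (hΩ : IsOpen Ω) {φ ψ : ℂ → ℂ}
    (h : IsRiemannPair Ω φ ψ) : constK p q Ω ψ ≠ 0 := by
  intro hK
  let b₁ : ContDiffBump (0 : ℂ) := ⟨1 / 4, 1 / 2, by norm_num, by norm_num⟩
  let b₂ : ContDiffBump (0 : ℂ) := ⟨1 / 2, 3 / 4, by norm_num, by norm_num⟩
  have hs₁ : tsupport b₁ = closedBall (0 : ℂ) (1 / 2) := b₁.tsupport_eq
  have hs₂ : tsupport b₂ = closedBall (0 : ℂ) (3 / 4) := b₂.tsupport_eq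
  have hb₁ : ContDiff ℝ ∞ b₁ := b₁.contDiff
  have hb₂ : ContDiff ℝ ∞ b₂ := b₂.contDiff
  set f := testPullback Ω φ b₁ fun _ ↦ 1 with hf
  have hsub₁ : tsupport b₁ ⊆ unitDisc := by
    rw [hs₁]; exact closedBall_subset_ball (by norm_num)
  have hfd : ContDiff ℝ ∞ f :=
    h.contDiff_testPullback hΩ hb₁ b₁.hasCompactSupport hsub₁ contDiffOn_const
  have hfc : HasCompactSupport f :=
    h.hasCompactSupport_testPullback hΩ b₁.hasCompactSupport hsub₁
  set η : ℂ → ℝ := fun z ↦ z.re * b₂ z with hη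
  have hηd : ContDiff ℝ ∞ η := Complex.reCLM.contDiff.mul hb₂
  have hηc : HasCompactSupport η := b₂.hasCompactSupport.mul_left
  have hηs : tsupport η ⊆ unitDisc := by
    refine (tsupport_mul_subset_right (f := fun z : ℂ ↦ z.re) (g := b₂)).trans ?_
    rw [hs₂]; exact closedBall_subset_ball (by norm_num)
  have hzero := integral_mul_fderiv_eq_zero_of_constK_eq_zero hq hK
    (memL1p_of_contDiff_hasCompactSupport Ω hfd hfc p) hηd hηc hηs 1
  have heq : ∫ w in unitDisc, f (ψ w) * fderiv ℝ η w 1 = ∫ w, b₁ w := by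
    rw [← setIntegral_eq_integral_of_forall_compl_eq_zero (s := unitDisc)
      fun z hz ↦ image_eq_zero_of_notMem_tsupport fun h ↦ hz (hsub₁ h)]
    refine setIntegral_congr_fun measurableSet_unitDisc fun w hw ↦ ?_
    have e1 : f (ψ w) = b₁ w := by
      rw [hf, testPullback, indicator_of_mem (h.right_mem hw), h.left_right hw, mul_one]
    simp only [e1]
    by_cases hw' : w ∈ ball (0 : ℂ) (1 / 2)
    · have hev : η =ᶠ[nhds w] fun z ↦ z.re := by
        filter_upwards [isOpen_ball.mem_nhds hw'] with z hz
        have : b₂ z = 1 := b₂.one_of_mem_closedBall (ball_subset_closedBall hz)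
        simp only [hη, this, mul_one]
      have hd : fderiv ℝ (fun z : ℂ ↦ z.re) w = Complex.reCLM := Complex.reCLM.fderiv
      rw [hev.fderiv_eq, hd]
      simp
    · have : b₁ w = 0 := by
        have : w ∉ Function.support b₁ := by rwa [b₁.support_eq]
        simpa using this
      rw [this, zero_mul]
  rw [heq] at hzero
  exact (b₁.integral_pos (μ := volume)).ne' hzero

/-! ### The composition operator and the weighted inequality -/

section Composition

variable {Ω : Set ℂ} {φ ψ : ℂ → ℂ}

/-- Hölder with exponents `p/q` and `p/(p-q)`, after inserting `|ψ'|^(2-p)` next to `|ψ'|^p |G ∘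
ψ|^p`: the power of `ψ'` becomes the Jacobian `|ψ'|²`, and this factor integrates to `∫ |G|^p` over
`Ω`. -/
theorem lintegral_rpow_comp_conformal_le (h : IsRiemannPair Ω φ ψ) (hΩ : IsOpen Ω) {p q : ℝ}
    (hq : 1 ≤ q) (hqp : q < p) {G : ℂ → ℂ}
    (hm : AEStronglyMeasurable (fun w ↦ starRingEnd ℂ (deriv ψ w) * G (ψ w))
      (volume.restrict unitDisc)) :
    ∫⁻ w in unitDisc, ‖starRingEnd ℂ (deriv ψ w) * G (ψ w)‖ₑ ^ q ≤
      (∫⁻ z in Ω, ‖G z‖ₑ ^ p) ^ (q / p) *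
        (∫⁻ w in unitDisc, ‖deriv ψ w‖ₑ ^ ((p - 2) * q / (p - q))) ^ ((p - q) / p) := by
  have hq0 : 0 < q := by linarith
  have hp0 : 0 < p := by linarith
  have hpq : 0 < p - q := by linarith
  set H : ℂ → ℂ := fun w ↦ starRingEnd ℂ (deriv ψ w) * G (ψ w) with hH
  set β := (p - 2) * q / (p - q) with hβ
  have hdm : Measurable fun w ↦ ‖deriv ψ w‖ₑ := (measurable_deriv ψ).enorm
  have hne : ∀ w ∈ unitDisc, ‖deriv ψ w‖ₑ ≠ 0 := fun w hw ↦ by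
    simpa using h.deriv_right_ne_zero hΩ hw
  have hHn : ∀ w, ‖H w‖ₑ = ‖deriv ψ w‖ₑ * ‖G (ψ w)‖ₑ := fun w ↦ by
    rw [hH, enorm_mul, ← ofReal_norm (starRingEnd ℂ _), RCLike.norm_conj, ofReal_norm]
  calc ∫⁻ w in unitDisc, ‖H w‖ₑ ^ q
      = ∫⁻ w in unitDisc, (‖deriv ψ w‖ₑ ^ (2 - p) * ‖H w‖ₑ ^ p) ^ (q / p) *
          (‖deriv ψ w‖ₑ ^ β) ^ ((p - q) / p) := by
        refine setLIntegral_congr_fun measurableSet_unitDisc fun w hw ↦ ?_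
        rw [ENNReal.mul_rpow_of_nonneg _ _ (by positivity), ← ENNReal.rpow_mul, ← ENNReal.rpow_mul,
          ← ENNReal.rpow_mul, mul_right_comm, ← ENNReal.rpow_add _ _ (hne w hw) (by simp)]
        have e1 : (2 - p) * (q / p) + β * ((p - q) / p) = 0 := by
          rw [hβ]; field_simp; ring
        have e2 : p * (q / p) = q := by field_simp
        rw [e1, e2, ENNReal.rpow_zero, one_mul]
    _ ≤ (∫⁻ w in unitDisc, ‖deriv ψ w‖ₑ ^ (2 - p) * ‖H w‖ₑ ^ p) ^ (q / p) *
          (∫⁻ w in unitDisc, ‖deriv ψ w‖ₑ ^ β) ^ ((p - q) / p) :=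
        ENNReal.lintegral_mul_norm_pow_le
          ((hdm.pow_const _).aemeasurable.mul (hm.enorm.pow_const p))
          (hdm.pow_const _).aemeasurable (by positivity) (by positivity)
          (by field_simp; ring)
    _ = _ := by
        congr 2
        rw [h.lintegral_eq hΩ]
        refine setLIntegral_congr_fun measurableSet_unitDisc fun w hw ↦ ?_
        rw [hHn, ENNReal.mul_rpow_of_nonneg _ _ hp0.le, ← mul_assoc,
          ← ENNReal.rpow_add _ _ (hne w hw) (by simp), sub_add_cancel, ENNReal.rpow_two]

/-- The norm of the composition operator. -/
theorem constK_le (h : IsRiemannPair Ω φ ψ) (hΩ : IsOpen Ω) {p q : ℝ} (hq : 1 ≤ q) (hqp : q < p) :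
    constK p q Ω ψ ≤
      (∫⁻ w in unitDisc, ‖deriv ψ w‖ₑ ^ ((p - 2) * q / (p - q))) ^ ((p - q) / (p * q)) := by
  have hq0 : 0 < q := by linarith
  have hp0 : 0 < p := by linarith
  have hpq : 0 < p - q := by linarith
  set I := (∫⁻ w in unitDisc, ‖deriv ψ w‖ₑ ^ ((p - 2) * q / (p - q))) ^ ((p - q) / (p * q)) with hI
  rcases eq_or_ne I ⊤ with hIt | hIt
  · rw [hIt]; exact le_top
  rw [← ENNReal.coe_toNNReal hIt]
  refine iInf₂_le _ fun f G hf ↦ ?_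
  have hw := hf.weakGrad.comp_conformal h hΩ
  have hm := hw.locInt_grad.aestronglyMeasurable
  have hle : eLpNorm (fun w ↦ starRingEnd ℂ (deriv ψ w) * G (ψ w)) (ENNReal.ofReal q)
      (volume.restrict unitDisc) ≤
        I * eLpNorm G (ENNReal.ofReal p) (volume.restrict Ω) := by
    rw [eLpNorm_ofReal_eq _ hq0, eLpNorm_ofReal_eq _ hp0]
    refine (ENNReal.rpow_le_rpow (lintegral_rpow_comp_conformal_le h hΩ hq hqp hm)
      (by positivity)).trans (le_of_eq ?_)
    rw [ENNReal.mul_rpow_of_nonneg _ _ (by positivity), ← ENNReal.rpow_mul, ← ENNReal.rpow_mul,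
      mul_comm, hI]
    congr 2
    · field_simp
    · field_simp
  rw [ENNReal.coe_toNNReal hIt]
  exact ⟨_, ⟨hw, hm, hle.trans_lt (ENNReal.mul_lt_top hIt.lt_top hf.memLp_grad.2)⟩, hle⟩

lemma eLpNorm_conformalMeasure (h : IsRiemannPair Ω φ ψ) (hΩ : IsOpen Ω) (g : ℂ → ℝ) {r : ℝ}
    (hr : 0 < r) :
    eLpNorm g (ENNReal.ofReal r) (conformalMeasure Ω φ) =
      eLpNorm (fun w ↦ g (ψ w)) (ENNReal.ofReal r) (volume.restrict unitDisc) := by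
  rw [eLpNorm_ofReal_eq _ hr, eLpNorm_ofReal_eq _ hr, conformalMeasure,
    lintegral_withDensity_eq_lintegral_mul_non_measurable _ ((measurable_deriv φ).enorm.pow_const 2)
      (Filter.Eventually.of_forall fun z ↦ by simp), ← h.image_left,
    lintegral_image_holomorphic hΩ h.conformal.holo h.conformal.bij.injOn hΩ.measurableSet
      subset_rfl]
  congr 1
  refine setLIntegral_congr_fun hΩ.measurableSet fun z hz ↦ ?_
  simp only [Pi.mul_apply, h.right_left hz]

/-- For admissible constants this is composition: `f ∘ ψ` lies in `L^{1,q}`, hence in `W^{1,q}` of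
the disc, and the weighted norm is a norm on the disc. Either best constant may be infinite, so
passing to infima needs the other to be nonzero. -/
theorem constBWeighted_le (h : IsRiemannPair Ω φ ψ) (hΩ : IsOpen Ω) {p q r : ℝ} (hr : 1 ≤ r)
    (hq1 : 1 ≤ q) (hq2 : q < 2) :
    constBWeighted r p Ω φ ≤ constB r q unitDisc * constK p q Ω ψ := by
  have hB0 : constB r q unitDisc ≠ 0 := constB_unitDisc_ne_zero hr
  have hK0 : constK p q Ω ψ ≠ 0 := constK_ne_zero hq1 hΩ h
  have hfeas : ∀ B K : ℝ≥0, PoincareSobolev unitDisc (volume.restrict unitDisc) r q B →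
      (∀ (f : ℂ → ℝ) (G : ℂ → ℂ), MemL1p Ω p f G → ∃ H : ℂ → ℂ, MemL1p unitDisc q (f ∘ ψ) H ∧
        eLpNorm H (ENNReal.ofReal q) (volume.restrict unitDisc) ≤
          K * eLpNorm G (ENNReal.ofReal p) (volume.restrict Ω)) →
      constBWeighted r p Ω φ ≤ (B : ℝ≥0∞) * K := by
    intro B K hB hK
    have : PoincareSobolev Ω (conformalMeasure Ω φ) r p (B * K) := by
      intro f G hf
      obtain ⟨H, hH, hle⟩ := hK f G ⟨hf.weakGrad, hf.memLp_grad⟩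
      have h1 := hB _ _ (hH.memW1p hq1 hq2)
      have e : ∀ c : ℝ, eLpNorm (fun z ↦ f z - c) (ENNReal.ofReal r) (conformalMeasure Ω φ) =
          eLpNorm (fun w ↦ (f ∘ ψ) w - c) (ENNReal.ofReal r) (volume.restrict unitDisc) :=
        fun c ↦ eLpNorm_conformalMeasure h hΩ _ (by linarith)
      simp_rw [e]
      refine h1.trans ?_
      rw [ENNReal.coe_mul, mul_assoc]
      exact mul_le_mul' le_rfl hle
    rw [← ENNReal.coe_mul]
    exact this.poincareConst_le
  rcases eq_or_ne (constK p q Ω ψ) ⊤ with hKt | hKt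
  · rw [hKt, ENNReal.mul_top hB0]; exact le_top
  rw [mul_comm]
  refine le_mul_iInf_coe hKt (.inl hK0) fun B hB ↦ ?_
  rw [mul_comm]
  refine le_mul_iInf_coe ENNReal.coe_ne_top (.inl fun h0 ↦ hB0 ?_) fun K hK ↦ hfeas B K hB hK
  exact le_antisymm (hB.poincareConst_le.trans h0.le) zero_le

/-- Hölder with exponents `α/(α-2)` and `α/2`, the weight `|φ'|²` being inserted and compensated.
The compensating factor is the integral of `|φ'|^(2-α)`, which on the disc becomes that of `|ψ'|²
|ψ'|^(α-2)`. -/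
lemma lintegral_rpow_le_mul_conformalMeasure (h : IsRiemannPair Ω φ ψ) (hΩ : IsOpen Ω) {α s : ℝ}
    (hα : 2 < α) {g : ℂ → ℝ} (hg : AEStronglyMeasurable g (volume.restrict Ω)) :
    ∫⁻ z in Ω, ‖g z‖ₑ ^ s ≤
      (∫⁻ z in Ω, ‖deriv φ z‖ₑ ^ 2 * ‖g z‖ₑ ^ (α * s / (α - 2))) ^ ((α - 2) / α) *
        (∫⁻ w in unitDisc, ‖deriv ψ w‖ₑ ^ α) ^ (2 / α) := by
  have hα2 : 0 < α - 2 := by linarith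
  have hα0 : 0 < α := by linarith
  have hdm : Measurable fun z ↦ ‖deriv φ z‖ₑ := (measurable_deriv φ).enorm
  have hne : ∀ z ∈ Ω, ‖deriv φ z‖ₑ ≠ 0 := fun z hz ↦ by
    simpa using h.deriv_left_ne_zero hΩ hz
  have hm1 : AEMeasurable (fun z ↦ ‖deriv φ z‖ₑ ^ 2 * ‖g z‖ₑ ^ (α * s / (α - 2)))
      (volume.restrict Ω) :=
    (hdm.pow_const 2).aemeasurable.mul (hg.enorm.pow_const (α * s / (α - 2)))
  have hm2 : AEMeasurable (fun z ↦ ‖deriv φ z‖ₑ ^ (2 - α)) (volume.restrict Ω) :=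
    (hdm.pow_const (2 - α)).aemeasurable
  calc ∫⁻ z in Ω, ‖g z‖ₑ ^ s
      = ∫⁻ z in Ω, (‖deriv φ z‖ₑ ^ 2 * ‖g z‖ₑ ^ (α * s / (α - 2))) ^ ((α - 2) / α) *
          (‖deriv φ z‖ₑ ^ (2 - α)) ^ (2 / α) := by
        refine setLIntegral_congr_fun hΩ.measurableSet fun z hz ↦ ?_
        rw [ENNReal.mul_rpow_of_nonneg _ _ (by positivity), ← ENNReal.rpow_two, ← ENNReal.rpow_mul,
          ← ENNReal.rpow_mul, ← ENNReal.rpow_mul, mul_right_comm,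
          ← ENNReal.rpow_add _ _ (hne z hz) (by simp)]
        have e1 : 2 * ((α - 2) / α) + (2 - α) * (2 / α) = 0 := by field_simp; ring
        have e2 : α * s / (α - 2) * ((α - 2) / α) = s := by field_simp
        rw [e1, e2, ENNReal.rpow_zero, one_mul]
    _ ≤ (∫⁻ z in Ω, ‖deriv φ z‖ₑ ^ 2 * ‖g z‖ₑ ^ (α * s / (α - 2))) ^ ((α - 2) / α) *
          (∫⁻ z in Ω, ‖deriv φ z‖ₑ ^ (2 - α)) ^ (2 / α) :=
        ENNReal.lintegral_mul_norm_pow_le hm1 hm2 (by positivity) (by positivity)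
          (by rw [← add_div, sub_add_cancel, div_self hα0.ne'])
    _ = _ := by
        congr 2
        rw [h.lintegral_eq hΩ]
        refine setLIntegral_congr_fun measurableSet_unitDisc fun w hw ↦ ?_
        have hw0 : ‖deriv ψ w‖ₑ ≠ 0 := by simpa using h.deriv_right_ne_zero hΩ hw
        have e : ‖deriv φ (ψ w)‖ₑ = ‖deriv ψ w‖ₑ⁻¹ := by
          rw [h.deriv_right hΩ hw, enorm_inv (h.deriv_left_ne_zero hΩ (h.right_mem hw)), inv_inv]
        rw [e, ENNReal.inv_rpow, ← ENNReal.rpow_neg, ← ENNReal.rpow_two,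
          ← ENNReal.rpow_add _ _ hw0 (by simp)]
        congr 1
        ring

theorem constB_le (h : IsRiemannPair Ω φ ψ) (hΩ : IsOpen Ω) {α s p : ℝ} (hα : 2 < α) (hs : 1 ≤ s)
    (hD : derivNorm α ψ ≠ ⊤) (hfin : constBWeighted (α * s / (α - 2)) p Ω φ < ⊤) :
    constB s p Ω ≤ derivNorm α ψ ^ (2 / s) * constBWeighted (α * s / (α - 2)) p Ω φ := by
  have hα2 : 0 < α - 2 := by linarith
  have hα0 : 0 < α := by linarith
  have hs0 : 0 < s := by linarith
  set r := α * s / (α - 2) with hr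
  have hr0 : 0 < r := by positivity
  set A := derivNorm α ψ ^ (2 / s) with hA
  have hAt : A ≠ ⊤ := ENNReal.rpow_ne_top_of_nonneg (by positivity) hD
  refine le_mul_iInf_coe hAt (.inr (exists_of_iInf_coe_lt_top hfin)) fun B hB ↦ ?_
  have hPS : PoincareSobolev Ω (volume.restrict Ω) s p (A.toNNReal * B) := by
    intro f G hf
    have hle : ∀ c : ℝ, eLpNorm (fun z ↦ f z - c) (ENNReal.ofReal s) (volume.restrict Ω) ≤
        A * eLpNorm (fun z ↦ f z - c) (ENNReal.ofReal r) (conformalMeasure Ω φ) := by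
      intro c
      have hm : AEStronglyMeasurable (fun z ↦ f z - c) (volume.restrict Ω) :=
        hf.memLp.1.sub aestronglyMeasurable_const
      rw [eLpNorm_ofReal_eq _ hs0, eLpNorm_ofReal_eq _ hr0, conformalMeasure,
        lintegral_withDensity_eq_lintegral_mul_non_measurable _
          ((measurable_deriv φ).enorm.pow_const 2) (Filter.Eventually.of_forall fun z ↦ by simp)]
      refine (ENNReal.rpow_le_rpow (lintegral_rpow_le_mul_conformalMeasure h hΩ hα hm)
        (by positivity)).trans (le_of_eq ?_)
      rw [ENNReal.mul_rpow_of_nonneg _ _ (by positivity), ← ENNReal.rpow_mul, ← ENNReal.rpow_mul,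
        mul_comm, hA, derivNorm, eLpNorm_ofReal_eq _ hα0, ← ENNReal.rpow_mul]
      congr 2
      · field_simp
      · rw [hr]; field_simp
    calc (⨅ c : ℝ, eLpNorm (fun z ↦ f z - c) (ENNReal.ofReal s) (volume.restrict Ω))
        ≤ ⨅ c : ℝ, A * eLpNorm (fun z ↦ f z - c) (ENNReal.ofReal r) (conformalMeasure Ω φ) :=
          iInf_mono hle
      _ = A * ⨅ c : ℝ, eLpNorm (fun z ↦ f z - c) (ENNReal.ofReal r) (conformalMeasure Ω φ) :=
          (ENNReal.mul_iInf fun h ↦ absurd h hAt).symm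
      _ ≤ A * (B * eLpNorm G (ENNReal.ofReal p) (volume.restrict Ω)) :=
          mul_le_mul' le_rfl (hB f G hf)
      _ = _ := by rw [ENNReal.coe_mul, ENNReal.coe_toNNReal hAt, mul_assoc]
  refine hPS.poincareConst_le.trans (le_of_eq ?_)
  rw [ENNReal.coe_mul, ENNReal.coe_toNNReal hAt]

end Composition

/-! ### The exponents and the main theorem. -/

/-- The exponents of the main theorem: the choice `q = a p / (2 + a - p)`, for which the
composition operator is controlled by the integral of `|ψ'|^(-a)`. -/
lemma brennan_exponent {a α p s : ℝ} (ha0 : 0 < a) (ha2 : a < 2) (hα : 2 < α) (hp1 : 4 / 3 < p)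
    (hp2 : p < 2) (hs1 : 1 ≤ s) (hs : s ≤ (α - 2) / α * (p / (2 - p)) * (a / (2 + a))) :
    1 ≤ a * p / (2 + a - p) ∧ a * p / (2 + a - p) < 2 * p / (4 - p) ∧
      (p - 2) * (a * p / (2 + a - p)) / (p - a * p / (2 + a - p)) = -a ∧
      α * s / (α - 2) ≤ a * p / (2 + a - p) / (2 - a * p / (2 + a - p)) := by
  have hα2 : 0 < α - 2 := by linarith
  have hα0 : 0 < α := by linarith
  have h2p : 0 < 2 - p := by linarith
  have hp0 : 0 < p := by linarith
  have hd : 0 < 2 + a - p := by linarith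
  have hr : α * s / (α - 2) ≤ p * a / ((2 - p) * (2 + a)) := by
    rw [div_le_iff₀ hα2]
    calc α * s ≤ α * ((α - 2) / α * (p / (2 - p)) * (a / (2 + a))) := by gcongr
      _ = _ := by field_simp
  have hr1 : 1 ≤ α * s / (α - 2) := by
    rw [le_div_iff₀ hα2]; nlinarith
  -- Since `1 ≤ r`, the bound on `r` is itself at least `1`; this inequality is equivalent to `1 ≤
  -- q`.
  have h1 : (2 - p) * (2 + a) ≤ p * a := by
    have := hr1.trans hr
    rwa [le_div_iff₀ (by positivity), one_mul] at this
  have hq2 : 2 - a * p / (2 + a - p) = (2 - p) * (2 + a) / (2 + a - p) := by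
    field_simp; ring
  have hpq : p - a * p / (2 + a - p) = p * (2 - p) / (2 + a - p) := by
    field_simp; ring
  refine ⟨?_, ?_, ?_, ?_⟩
  · rw [le_div_iff₀ hd]; nlinarith
  · rw [div_lt_div_iff₀ hd (by linarith)]
    -- This product is the difference of the two sides after cross-multiplication.
    have : 0 < p * ((2 - a) * (2 - p)) := by
      have : 0 < 2 - a := by linarith
      positivity
    nlinarith
  · rw [hpq]
    have : p * (2 - p) ≠ 0 := by positivity
    field_simp
    ring
  · rw [hq2]
    refine hr.trans (le_of_eq ?_)
    field_simp

theorem theoremB (α₀ : ℝ) (hα₀ : α₀ ∈ Ioo (-2 : ℝ) 0) (hBrennan : BrennanConjectureOn α₀)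
    (α : ℝ) (Ω : Set ℂ) (hΩ : IsConformalRegular α Ω)
    (φ ψ : ℂ → ℂ) (hφ : IsRiemannPair Ω φ ψ)
    (p : ℝ)
    (hp : p ∈ Ioo (max (4 / 3) (2 * α * (|α₀| + 2) / (2 * α + 3 * α * |α₀| - 4 * |α₀|))) 2)
    (s : ℝ) (hs : s ∈ Icc 1 ((α - 2) / α * (p / (2 - p)) * (|α₀| / (2 + |α₀|)))) :
    -- the inequality holds with the finite constant `B_{s,p}(Ω)`
    (constB s p Ω < ⊤ ∧
      ∀ (f : ℂ → ℝ) (G : ℂ → ℂ), MemW1p Ω p f G →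
        (⨅ c : ℝ, eLpNorm (fun z => f z - c) (ENNReal.ofReal s) (volume.restrict Ω)) ≤
          constB s p Ω * eLpNorm G (ENNReal.ofReal p) (volume.restrict Ω)) ∧
    -- the estimates of the constant, whose last term is finite
    constB s p Ω ≤ derivNorm α ψ ^ (2 / s) * constBWeighted (α * s / (α - 2)) p Ω φ ∧
    derivNorm α ψ ^ (2 / s) * constBWeighted (α * s / (α - 2)) p Ω φ ≤
      (⨅ q ∈ Ico 1 (2 * p / (4 - p)),
        constB (α * s / (α - 2)) q unitDisc * derivNorm α ψ ^ (2 / s) * constK p q Ω ψ) ∧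
    (⨅ q ∈ Ico 1 (2 * p / (4 - p)),
      constB (α * s / (α - 2)) q unitDisc * derivNorm α ψ ^ (2 / s) * constK p q Ω ψ) < ⊤ ∧
    -- the bound of the norms of the composition operators
    ∀ q ∈ Ico 1 (2 * p / (4 - p)),
      constK p q Ω ψ ≤
        (∫⁻ w in unitDisc, ‖deriv ψ w‖ₑ ^ ((p - 2) * q / (p - q))) ^ ((p - q) / (p * q)) := by
  obtain ⟨hα, ⟨hΩo, -⟩, -⟩ := id hΩ
  obtain ⟨ha1, ha2⟩ := hα₀
  obtain ⟨hp1, hp2⟩ := hp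
  obtain ⟨hs1, hs2⟩ := hs
  have hp43 : 4 / 3 < p := (le_max_left _ _).trans_lt hp1
  have habs : |α₀| = -α₀ := abs_of_neg ha2
  have hr1 : 1 ≤ α * s / (α - 2) := by
    rw [le_div_iff₀ (by linarith)]; nlinarith
  have hq2 : ∀ q ∈ Ico 1 (2 * p / (4 - p)), q < 2 ∧ q < p := by
    intro q hq
    have h4 : 0 < 4 - p := by linarith
    have h1 := (lt_div_iff₀ h4).mp hq.2
    constructor <;> nlinarith [hq.1]
  have hKle : ∀ q ∈ Ico 1 (2 * p / (4 - p)), constK p q Ω ψ ≤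
      (∫⁻ w in unitDisc, ‖deriv ψ w‖ₑ ^ ((p - 2) * q / (p - q))) ^ ((p - q) / (p * q)) :=
    fun q hq ↦ constK_le hφ hΩo hq.1 (hq2 q hq).2
  have hDt : derivNorm α ψ ≠ ⊤ := by
    rw [derivNorm, eLpNorm_ofReal_eq _ (by linarith)]
    exact ENNReal.rpow_ne_top_of_nonneg (by positivity) (hΩ.lintegral_deriv_lt_top hφ).ne
  have hDst : derivNorm α ψ ^ (2 / s) ≠ ⊤ := ENNReal.rpow_ne_top_of_nonneg (by positivity) hDt
  obtain ⟨e1, e2, e3, e4⟩ := brennan_exponent (a := |α₀|) (by rw [habs]; linarith)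
    (by rw [habs]; linarith) hα hp43 hp2 hs1 hs2
  -- The estimates hold for every admissible `q`. Finiteness needs only this one, where the exponent
  -- of `|ψ'|` is the endpoint `α₀` of Brennan's range.
  set q₀ := |α₀| * p / (2 + |α₀| - p) with hq₀
  have hq₀mem : q₀ ∈ Ico 1 (2 * p / (4 - p)) := ⟨e1, e2⟩
  obtain ⟨hq₀2, hq₀p⟩ := hq2 q₀ hq₀mem
  have hB₀ : constB (α * s / (α - 2)) q₀ unitDisc < ⊤ :=
    constB_unitDisc_lt_top e1 hq₀2 e4 hr1
  have hK₀ : constK p q₀ Ω ψ < ⊤ := by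
    refine (hKle q₀ hq₀mem).trans_lt (ENNReal.rpow_lt_top_of_nonneg ?_ ?_)
    · have : 0 ≤ p - q₀ := by linarith
      positivity
    · rw [e3, habs, neg_neg]
      exact (hBrennan Ω ψ hΩ.2.1 (hφ.isConformalOnto_right hΩo) α₀ ⟨le_rfl, by linarith⟩).ne
  have hW : ∀ q ∈ Ico 1 (2 * p / (4 - p)), constBWeighted (α * s / (α - 2)) p Ω φ ≤
      constB (α * s / (α - 2)) q unitDisc * constK p q Ω ψ :=
    fun q hq ↦ constBWeighted_le hφ hΩo hr1 hq.1 (hq2 q hq).1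
  have hWt : constBWeighted (α * s / (α - 2)) p Ω φ < ⊤ :=
    (hW q₀ hq₀mem).trans_lt (ENNReal.mul_lt_top hB₀ hK₀)
  have hle := constB_le hφ hΩo hα hs1 hDt hWt
  have hBt : constB s p Ω < ⊤ := hle.trans_lt (ENNReal.mul_lt_top hDst.lt_top hWt)
  refine ⟨⟨hBt, fun f G hf ↦ iInf_eLpNorm_le_poincareConst_mul hBt hf⟩, hle, ?_, ?_, hKle⟩
  · refine le_iInf₂ fun q hq ↦ ?_
    rw [mul_right_comm, mul_comm]
    exact mul_le_mul' (hW q hq) le_rfl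
  · refine (iInf₂_le q₀ hq₀mem).trans_lt ?_
    exact ENNReal.mul_lt_top (ENNReal.mul_lt_top hB₀ hDst.lt_top) hK₀
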